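/- Let $p>2$ be a prime, $\omega:\mathbb{Z}_p^*\to\mathbb{Z}_p^*$ the Teichmüller character modulo $p$, and $\langle a\rangle=a/\omega(a)\in 1+p\mathbb{Z}_p$ for $a\in\mathbb{Z}_p^*$. Let $\chi$ be a Dirichlet character of $p$-power conductor with values in $\mathbb{C}_p$, and let $L_p(s,\chi)$ be the $p$-adic $L$-function of $\chi$, i.e. the continuous $p$-adic interpolation to $s\in\mathbb{Z}_p$ ($s\neq 1$ if $\chi=1$) of the values $$L_p(1-k,\chi)=-\bigl(1-\chi\omega^{-k}(p)\,p^{k-1}\bigr)\frac{B_{k,\chi\omega^{-k}}}{k}\qquad(k=1,2,3,\dots),$$ where $\chi\omega^{-k}$ denotes the associated primitive character and $B_{k,\psi}=f^{k-1}\sum_{a=1}^{f}\psi(a)B_k(a/f)$ is the generalized Bernoulli number of a character $\psi$ of conductor $f$. Then this interpolation exists, and the following hold. (1) For every $s\in\mathbb{Z}_p$ the limit below exists in $\mathbb{C}_p$. For every $s\in\mathbb{Z}_p$, except $s=1$ in case $\chi(2)=1$, one has $1-\chi(2)\langle 2\rangle^{1-s}\neq 0$ and $$L_p(s,\chi)=\frac{-1}{1-\chi(2)\langle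 2\rangle^{1-s}}\cdot\lim_{n\to\infty}\sum_{\substack{1\le a\le p^n\\ p\nmid a}}\frac{(-1)^a}{2}\,\chi\omega^{-1}(a)\,\langle a\rangle^{-s}.$$ (2) If $\chi\neq 1$, then $L_p(s,\chi)$ is analytic on $\mathbb{Z}_p$ (given on all of $\mathbb{Z}_p$ by a power series whose coefficients tend to $0$). If $\chi=1$, then $L_p(s,\chi)$ is analytic on $\mathbb{Z}_p$ except for a simple pole at $s=1$: it equals $\frac{r}{s-1}+h(s)$ for all $s\ne 1$, with $r\neq 0$ and $h$ analytic on $\mathbb{Z}_p$. (3) For $i=0,1,\dots,p-2$ let $\zeta_{p,i}(s)=L_p(s,\omega^{1-i})$ be the $i$-th branch of the $p$-adic zeta function. For every $s\in\mathbb{Z}_p$ the limit below exists, and for every $s\in\mathbb{Z}_p$, except $s=1$ in case $\omega(2)^{1-i}=1$, the denominator is nonzero and $$\zeta_{p,i}(s)=\frac{-1}{1-\omega(2)^{1-i}\langle 2\rangle^{1-s}}\cdot\lim_{n\to\infty}\sum_{\substack{1\le a\le p^n\\ p\nmid a}}\frac{(-1)^a}{2}\,\omega(a)^{-i}\,\langle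 a\rangle^{-s}.$$ -/

import Mathlib

open Filter Topology

namespace PadicDirichlet

noncomputable section

/-- The Teichmüller character modulo `p` with values in `ℤ_[p]`: the multiplicative lift
`ZMod p → W(ZMod p) ≅ ℤ_[p]`. -/
def teichmullerInt (p : ℕ) [Fact p.Prime] : MulChar (ZMod p) ℤ_[p] where
  toMonoidHom := ((WittVector.equiv p).toRingHom : WittVector p (ZMod p) →* ℤ_[p]).comp
    (WittVector.teichmuller p)
  map_nonunit' := by
    intro a ha
    have h : a = 0 := by
      by_contra h0
      exact ha (isUnit_iff_ne_zero.mpr h0)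
    subst h
    simp

/-- The lift is a lift: `ω(a) ≡ a` modulo `p`. -/
lemma toZMod_teichmullerInt (p : ℕ) [Fact p.Prime] (a : ZMod p) :
    PadicInt.toZMod (teichmullerInt p a) = a := by
  have hom : ∀ (f : ℤ_[p] →+* ZMod p) (x : ℤ_[p]), f x = PadicInt.toZMod x := by
    intro f x
    have h1 := PadicInt.toZMod_spec x
    rw [PadicInt.maximalIdeal_eq_span_p, Ideal.mem_span_singleton] at h1
    obtain ⟨y, hy⟩ := h1
    have h2 : f (x - (ZMod.cast (PadicInt.toZMod x) : ℤ_[p])) = 0 := by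
      rw [hy]; simp
    rw [ZMod.cast_eq_val, map_sub, map_natCast, ZMod.natCast_zmod_val, sub_eq_zero] at h2
    exact h2
  have h := hom ((WittVector.constantCoeff (p := p) (R := ZMod p)).comp
    (WittVector.equiv p).symm.toRingHom) (teichmullerInt p a)
  rw [← h]
  change ((WittVector.equiv p).symm ((WittVector.equiv p) (WittVector.teichmuller p a))).coeff 0 = a
  rw [RingEquiv.symm_apply_apply, WittVector.teichmuller_coeff_zero]

/-- The Teichmüller character `ω` modulo `p` as a Dirichlet character with values in `ℂ_[p]`. -/
def omega (p : ℕ) [Fact p.Prime] : DirichletCharacter ℂ_[p] p :=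
  ((teichmullerInt p).ringHomComp (algebraMap ℤ_[p] ℚ_[p])).ringHomComp (algebraMap ℚ_[p] ℂ_[p])

/-- `⟨a⟩ = a / ω(a)` for `a ∈ ℤ_[p]ˣ` (and `0` for a non-unit); note `1 / ω(a) = ω(a⁻¹)`. -/
def angle {p : ℕ} [Fact p.Prime] (a : ℤ_[p]) : ℤ_[p] :=
  a * teichmullerInt p (PadicInt.toZMod a)⁻¹

/-- `⟨a⟩ ∈ 1 + p ℤ_[p]` for a natural number `a` prime to `p`. -/
lemma norm_angle_sub_one_lt {p : ℕ} [Fact p.Prime] {a : ℕ} (ha : ¬ p ∣ a) :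
    ‖angle (a : ℤ_[p]) - 1‖ < 1 := by
  have h0 : (a : ZMod p) ≠ 0 := by rwa [Ne, ZMod.natCast_eq_zero_iff]
  have h : angle (a : ℤ_[p]) - 1 ∈ RingHom.ker (PadicInt.toZMod (p := p)) := by
    rw [RingHom.mem_ker, map_sub, angle, map_mul, toZMod_teichmullerInt, map_natCast, map_one,
      mul_inv_cancel₀ h0, sub_self]
  rw [PadicInt.ker_toZMod, IsLocalRing.mem_maximalIdeal] at h
  exact PadicInt.mem_nonunits.mp h

/-- `u ^ s` for `u ∈ 1 + p ℤ_[p]` and `s ∈ ℤ_[p]`: the binomial series `∑ₙ (s choose n) (u - 1)ⁿ`. -/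
def onePow {p : ℕ} [Fact p.Prime] (u s : ℤ_[p]) : ℤ_[p] :=
  (PadicInt.mahlerSeries (fun n : ℕ => (u - 1) ^ n) : C(ℤ_[p], ℤ_[p])) s

/-- `s ↦ u ^ s` is the continuous character of `ℤ_[p]` that takes the value `u` at `1`. -/
lemma onePow_eq_addChar {p : ℕ} [Fact p.Prime] {u : ℤ_[p]}
    (hu : Tendsto (fun n : ℕ => (u - 1) ^ n) atTop (𝓝 0)) (s : ℤ_[p]) :
    onePow u s = PadicInt.addChar_of_value_at_one (u - 1) hu s := rfl

/-- `⟨a⟩ ^ s` as an element of `ℂ_[p]`. -/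
def anglePow {p : ℕ} [Fact p.Prime] (a : ℕ) (s : ℤ_[p]) : ℂ_[p] :=
  algebraMap ℚ_[p] ℂ_[p] (onePow (angle (a : ℤ_[p])) s : ℚ_[p])

/-- The generalized Bernoulli number
`B_{k,ψ} = f^{k-1} ∑_{a=1}^{f} ψ(a) B_k(a/f)` (`k ≥ 1`) of a character `ψ` modulo `f`. -/
def generalizedBernoulli {p : ℕ} [Fact p.Prime] {f : ℕ} (k : ℕ) (ψ : DirichletCharacter ℂ_[p] f) :
    ℂ_[p] :=
  (f : ℂ_[p]) ^ (k - 1) * ∑ a ∈ Finset.Icc 1 f,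
    ψ (a : ZMod f) * (((Polynomial.bernoulli k).eval ((a : ℚ) / (f : ℚ)) : ℚ) : ℂ_[p])

/-- The primitive Dirichlet character `χ ω^{-k}`. -/
def twist {p : ℕ} [Fact p.Prime] {N : ℕ} (χ : DirichletCharacter ℂ_[p] N) (k : ℕ) :
    DirichletCharacter ℂ_[p] (χ.mul ((omega p) ^ (-(k : ℤ)))).conductor :=
  χ.primitive_mul ((omega p) ^ (-(k : ℤ)))

/-- The value `-(1 - χω^{-k}(p) p^{k-1}) B_{k,χω^{-k}} / k` to be interpolated at `s = 1 - k`, for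
`k ≥ 1`. -/
def interpolationValue {p : ℕ} [Fact p.Prime] {N : ℕ} (χ : DirichletCharacter ℂ_[p] N) (k : ℕ) :
    ℂ_[p] :=
  -(1 - twist χ k (p : ZMod _) * (p : ℂ_[p]) ^ (k - 1)) *
    (generalizedBernoulli k (twist χ k) / (k : ℂ_[p]))

/-- The Kubota-Leopoldt `p`-adic `L`-function `L_p(s, χ)`, for odd `p`: the `p`-adic interpolation of
the values above, that is, its value at `s ∈ ℤ_[p]` is the limit of the values at `1 - k` as
`1 - k → s` `p`-adically, `k` running through the positive integers. For trivial `χ` this is not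
meaningful at the pole `s = 1`. -/
def padicLFunction {p : ℕ} [Fact p.Prime] {N : ℕ} (χ : DirichletCharacter ℂ_[p] N) (s : ℤ_[p]) :
    ℂ_[p] :=
  limUnder (Filter.comap (fun k : ℕ+ => 1 - ((k : ℕ) : ℤ_[p])) (𝓝 s))
    (fun k : ℕ+ => interpolationValue χ (k : ℕ))

/-- The `i`-th branch `ζ_{p,i}(s) = L_p(s, ω^{1-i})` of the `p`-adic zeta function. -/
def padicZetaBranch (p : ℕ) [Fact p.Prime] (i : ℕ) (s : ℤ_[p]) : ℂ_[p] :=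
  padicLFunction ((omega p) ^ (1 - (i : ℤ))) s

/-- `p`-adic analytic functions on `ℤ_[p]`: those given on all of `ℤ_[p]` by one power series whose
coefficients tend to `0` (so that it converges on the closed unit disc). -/
def IsAnalyticOnZp {p : ℕ} [Fact p.Prime] (g : ℤ_[p] → ℂ_[p]) : Prop :=
  ∃ c : ℕ → ℂ_[p], Tendsto c atTop (𝓝 0) ∧
    ∀ s : ℤ_[p], HasSum (fun n => c n * (algebraMap ℚ_[p] ℂ_[p] (s : ℚ_[p])) ^ n) (g s)

/-- `g` is analytic on `ℤ_[p]` except for a simple pole at `s = 1` (the value `g 1` is irrelevant). -/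
def IsAnalyticWithSimplePoleAtOne {p : ℕ} [Fact p.Prime] (g : ℤ_[p] → ℂ_[p]) : Prop :=
  ∃ (r : ℂ_[p]) (h : ℤ_[p] → ℂ_[p]), r ≠ 0 ∧ IsAnalyticOnZp h ∧
    ∀ s : ℤ_[p], s ≠ 1 → g s = r / (algebraMap ℚ_[p] ℂ_[p] (s : ℚ_[p]) - 1) + h s

end

end PadicDirichlet

/-! Put t = 1 - s. Since ω(a) = a / ⟨a⟩, the alternating sum is that of c(a) a⁻¹ ⟨a⟩^t / 2, with c
the restriction of χ to numbers prime to p. The argument shows that its limit is a power series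
f(t), computes f at t = k = 1, 2, 3, ..., and divides by 1 - χ(2)⟨2⟩^t.

Convergence and analyticity (`IsPChar.exists_tendsto_ev`). As p is odd, alternating sums of
p-adically Lipschitz functions over 0 ≤ a < p^n are Cauchy. Expanding ⟨a⟩^t = ∑ (t choose j) (⟨a⟩ -
1)^j gives a Mahler series with coefficients O(p^{-j}). For p > 2 the denominators j! cost at most
p^{(j-1)/2}, so a power series in t with coefficients O(p^{-j/2}) remains.

Values at t = k (`IsPChar.eq_of_tendsto`, `interpolationValue_mul`). Let c = χω^{-k} away from p.
The Euler factor times B_{k,χω^{-k}} is B = lim p^{-n} ∑ c(a) a^k. Doubling a < p^n gives the even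
numbers below 2p^n. Those beyond p^n are x + p^n with x odd, and (x + p^n)^k - x^k ≈ k p^n x^{k-1}.
Hence (c(2) 2^k - 1) B is k times the limit of the sums of c(x) x^{k-1} over odd x. The full sums
tend to 0, so the odd sums tend to minus the halved alternating ones.

Division (`exists_numerator_residue_regular`). If the root of unity χ(2) is not 1, it is at distance
at least p^{-1/2} from 1, so 1 - χ(2)⟨2⟩^t is an invertible power series. If χ(2) = 1, the
denominator is t times an invertible series, and the residue is lim p^{-n} ∑ χ(a) over a prime to p:
it is 1 - 1/p for χ = 1 and 0 otherwise. This follows from the doubling estimate, uniform in k,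
along k → 0 in ℤ_p (`IsPChar.ev_zero_mul`).

The points 1 - k are dense in ℤ_p, so the continuous function so built is the interpolation. -/

namespace PadicDirichlet

noncomputable section

set_option linter.unusedSectionVars false

/-! ### Norms of p-adic integers inside an extension of ℚ_p -/

section Embedding

variable {p : ℕ} [Fact p.Prime] (K : Type*) [NormedField K] [NormedAlgebra ℚ_[p] K]

/-- The inclusion of `ℤ_[p]` into a normed field extension of `ℚ_[p]`. -/
def emb : ℤ_[p] →+* K := (algebraMap ℚ_[p] K).comp PadicInt.Coe.ringHom

lemma emb_apply (x : ℤ_[p]) : emb K x = algebraMap ℚ_[p] K (x : ℚ_[p]) := rfl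

@[simp] lemma norm_emb (x : ℤ_[p]) : ‖emb K x‖ = ‖x‖ := by
  rw [emb_apply, norm_algebraMap', PadicInt.norm_def]

lemma continuous_emb : Continuous (emb K : ℤ_[p] → K) :=
  (isometry_iff_norm.2 fun x y => by rw [← map_sub, norm_emb] : Isometry (emb K)).continuous
where
  isometry_iff_norm {f : ℤ_[p] → K} : Isometry f ↔ ∀ x y, ‖f x - f y‖ = ‖x - y‖ := by
    simp only [isometry_iff_dist_eq, dist_eq_norm]

lemma emb_injective : Function.Injective (emb K : ℤ_[p] → K) :=
  (injective_iff_map_eq_zero _).2 fun x hx => by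
    rw [← norm_eq_zero, ← norm_emb K, hx, norm_zero]

end Embedding

lemma norm_natCast_le_one (p : ℕ) [Fact p.Prime] (K : Type*) [NormedField K]
    [NormedAlgebra ℚ_[p] K] (n : ℕ) : ‖(n : K)‖ ≤ 1 := by
  rw [← map_natCast (emb (p := p) K), norm_emb]; exact PadicInt.norm_le_one _

lemma norm_intCast_le_one (p : ℕ) [Fact p.Prime] (K : Type*) [NormedField K]
    [NormedAlgebra ℚ_[p] K] (n : ℤ) : ‖(n : K)‖ ≤ 1 := by
  rw [← map_intCast (emb (p := p) K), norm_emb]; exact PadicInt.norm_le_one _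

lemma norm_prime (p : ℕ) [Fact p.Prime] (K : Type*) [NormedField K]
    [NormedAlgebra ℚ_[p] K] : ‖(p : K)‖ = (p : ℝ)⁻¹ := by
  rw [← map_natCast (emb (p := p) K), norm_emb, PadicInt.norm_p]

lemma norm_natCast_eq_one (p : ℕ) [Fact p.Prime] (K : Type*) [NormedField K]
    [NormedAlgebra ℚ_[p] K] {n : ℕ} (h : ¬ p ∣ n) : ‖(n : K)‖ = 1 := by
  rw [← map_natCast (emb (p := p) K), norm_emb]
  refine le_antisymm (PadicInt.norm_le_one _) (not_lt.1 fun h' => h ?_)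
  have := (PadicInt.norm_int_lt_one_iff_dvd (p := p) (n : ℤ)).1 (by exact_mod_cast h')
  exact_mod_cast this

/-- The radius `p^{-1/2}`. -/
def rad (p : ℕ) : ℝ := (√(p : ℝ))⁻¹

lemma rad_sq (p : ℕ) : rad p ^ 2 = (p : ℝ)⁻¹ := by
  rw [rad, inv_pow, Real.sq_sqrt (Nat.cast_nonneg p)]

section Rad

variable (p : ℕ) [hp : Fact p.Prime]

lemma rad_pos : 0 < rad p := by
  have : (0 : ℝ) < p := by exact_mod_cast hp.1.pos
  unfold rad; positivity

lemma rad_lt_one : rad p < 1 := by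
  have h1 : (1 : ℝ) < p := by exact_mod_cast hp.1.one_lt
  have h2 : rad p ^ 2 < 1 := by rw [rad_sq]; exact inv_lt_one_of_one_lt₀ h1
  exact (sq_lt_one_iff₀ (rad_pos p).le).1 h2

end Rad

section Factorial

variable {p : ℕ} [hp : Fact p.Prime] (K : Type*) [NormedField K] [NormedAlgebra ℚ_[p] K]

/-- By Legendre, (p - 1) v(n!) = n - (digit sum of n) ≤ n - 1, and p - 1 ≥ 2. This fixes the choice
of the radius p^{-1/2}. -/
lemma rad_pow_le_norm_factorial (hp2 : 2 < p) {n : ℕ} (hn : n ≠ 0) :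
    rad p ^ (n - 1) ≤ ‖(n.factorial : K)‖ := by
  have h1 := sub_one_mul_padicValNat_factorial (p := p) n
  have h2 : 1 ≤ (p.digits n).sum := by
    by_contra h
    have h0 : (p.digits n).sum = 0 := by omega
    have h3 := Nat.getLast_digit_ne_zero p hn
    rw [List.sum_eq_zero_iff] at h0
    exact h3 (h0 _ (List.getLast_mem _))
  have h3 : 2 * padicValNat p n.factorial ≤ n - 1 := by
    calc _ ≤ (p - 1) * padicValNat p n.factorial := Nat.mul_le_mul_right _ (by omega)
      _ ≤ n - 1 := by omega
  have h4 : ‖(n.factorial : K)‖ = rad p ^ (2 * padicValNat p n.factorial) := by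
    rw [← map_natCast (algebraMap ℚ_[p] K), norm_algebraMap', Padic.norm_eq_zpow_neg_valuation
      (by exact_mod_cast n.factorial_ne_zero), Padic.valuation_natCast, pow_mul, rad_sq,
      zpow_neg, zpow_natCast, inv_pow]
  rw [h4]
  exact pow_le_pow_of_le_one (rad_pos p).le (rad_lt_one p).le h3

end Factorial

/-! ### Power series with geometrically decaying coefficients -/

section PowerSeries

open PowerSeries

variable {p : ℕ} {K : Type*} [NormedField K]

/-- Power series whose `j`-th coefficient is bounded by `C p^{-j/2}`. -/
def IsBdd (p : ℕ) (C : ℝ) (f : K⟦X⟧) : Prop := ∀ j, ‖coeff j f‖ ≤ C * rad p ^ j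

lemma IsBdd.nonneg {C : ℝ} {f : K⟦X⟧} (hf : IsBdd p C f) : 0 ≤ C := by
  simpa using (norm_nonneg _).trans (hf 0)

variable [hp : Fact p.Prime]

lemma IsBdd.mul [IsUltrametricDist K] {C D : ℝ} {f g : K⟦X⟧} (hf : IsBdd p C f)
    (hg : IsBdd p D g) : IsBdd p (C * D) (f * g) := by
  intro j
  have hr := rad_pos p
  have hC := hf.nonneg
  have hD := hg.nonneg
  rw [coeff_mul]
  refine IsUltrametricDist.norm_sum_le_of_forall_le_of_nonneg (by positivity) fun x hx => ?_
  replace hx := Finset.HasAntidiagonal.mem_antidiagonal.1 hx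
  rw [norm_mul, ← hx, pow_add]
  calc _ ≤ (C * rad p ^ x.1) * (D * rad p ^ x.2) :=
        mul_le_mul (hf _) (hg _) (norm_nonneg _) (by positivity)
    _ = _ := by ring

lemma isBdd_C (c : K) : IsBdd p ‖c‖ (C c) := by
  intro j
  rw [coeff_C]
  have hr := rad_pos p
  split_ifs with h
  · simp [h]
  · rw [norm_zero]; positivity

/-- The recursion for the coefficients of the inverse divides only by the constant term, a unit, so
the ultrametric inequality preserves the bound. -/
lemma IsBdd.inv [IsUltrametricDist K] {f : K⟦X⟧} (hf : IsBdd p 1 f)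
    (h0 : ‖coeff 0 f‖ = 1) : IsBdd p 1 f⁻¹ := by
  have hr := rad_pos p
  intro j
  induction j using Nat.strong_induction_on with
  | _ j ih =>
    rw [coeff_inv, ← coeff_zero_eq_constantCoeff_apply]
    split_ifs with h
    · rw [norm_inv, h0, h]; simp
    · rw [norm_mul, norm_neg, norm_inv, h0, inv_one, one_mul]
      refine IsUltrametricDist.norm_sum_le_of_forall_le_of_nonneg (by positivity) fun x hx => ?_
      replace hx := Finset.HasAntidiagonal.mem_antidiagonal.1 hx
      split_ifs with h'
      · rw [norm_mul, ← hx, pow_add]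
        calc _ ≤ (1 * rad p ^ x.1) * (1 * rad p ^ x.2) :=
              mul_le_mul (hf _) (ih _ h') (norm_nonneg _) (by positivity)
          _ = _ := by ring
      · rw [norm_zero]; positivity

lemma summable_rad (p : ℕ) [Fact p.Prime] (C : ℝ) : Summable fun j => C * rad p ^ j :=
  (summable_geometric_of_lt_one (rad_pos p).le (rad_lt_one p)).mul_left C

lemma IsBdd.tendsto_coeff {C : ℝ} {f : K⟦X⟧} (hf : IsBdd p C f) :
    Tendsto (fun j => coeff j f) atTop (𝓝 0) :=
  squeeze_zero_norm hf (summable_rad p C).tendsto_atTop_zero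

variable [NormedAlgebra ℚ_[p] K]

/-- The value of a power series at a `p`-adic integer. -/
def ev (f : K⟦X⟧) (s : ℤ_[p]) : K := ∑' j, coeff j f * emb K s ^ j

lemma norm_coeff_mul_pow_le {C : ℝ} {f : K⟦X⟧} (hf : IsBdd p C f) (s : ℤ_[p]) (j : ℕ) :
    ‖coeff j f * emb K s ^ j‖ ≤ C * rad p ^ j := by
  rw [norm_mul, norm_pow, norm_emb]
  exact (mul_le_of_le_one_right (norm_nonneg _)
    (pow_le_one₀ (norm_nonneg _) (PadicInt.norm_le_one s))).trans (hf j)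

lemma ev_C (c : K) (s : ℤ_[p]) : ev (C c) s = c := by
  unfold ev
  rw [tsum_eq_single 0 fun j hj => by rw [coeff_C, if_neg hj, zero_mul]]
  simp

lemma ev_X (s : ℤ_[p]) : ev (X : K⟦X⟧) s = emb K s := by
  unfold ev
  rw [tsum_eq_single 1 fun j hj => by rw [coeff_X, if_neg hj, zero_mul]]
  simp

lemma ev_zero (f : K⟦X⟧) : ev f (0 : ℤ_[p]) = coeff 0 f := by
  unfold ev
  rw [tsum_eq_single 0 fun j hj => by rw [map_zero, zero_pow hj, mul_zero]]
  simp

variable [CompleteSpace K]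

lemma IsBdd.hasSum {C : ℝ} {f : K⟦X⟧} (hf : IsBdd p C f) (s : ℤ_[p]) :
    HasSum (fun j => coeff j f * emb K s ^ j) (ev f s) :=
  (Summable.of_norm_bounded (summable_rad p C) (norm_coeff_mul_pow_le hf s)).hasSum

lemma IsBdd.continuous {C : ℝ} {f : K⟦X⟧} (hf : IsBdd p C f) :
    Continuous (ev f : ℤ_[p] → K) :=
  continuous_tsum (fun j => continuous_const.mul ((continuous_emb K).pow j)) (summable_rad p C)
    fun j s => norm_coeff_mul_pow_le hf s j

lemma ev_mul {C D : ℝ} {f g : K⟦X⟧} (hf : IsBdd p C f) (hg : IsBdd p D g) (s : ℤ_[p]) :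
    ev (f * g) s = ev f s * ev g s := by
  unfold ev
  rw [tsum_mul_tsum_eq_tsum_sum_antidiagonal_of_summable_norm
    (Summable.of_nonneg_of_le (fun _ => norm_nonneg _) (norm_coeff_mul_pow_le hf s)
      (summable_rad p C))
    (Summable.of_nonneg_of_le (fun _ => norm_nonneg _) (norm_coeff_mul_pow_le hg s)
      (summable_rad p D))]
  refine tsum_congr fun j => ?_
  rw [coeff_mul, Finset.sum_mul]
  refine Finset.sum_congr rfl fun x hx => ?_
  replace hx := Finset.HasAntidiagonal.mem_antidiagonal.1 hx
  rw [← hx, pow_add]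
  ring

lemma ev_add {C D : ℝ} {f g : K⟦X⟧} (hf : IsBdd p C f) (hg : IsBdd p D g) (s : ℤ_[p]) :
    ev (f + g) s = ev f s + ev g s := by
  unfold ev
  rw [← (hf.hasSum s).summable.tsum_add (hg.hasSum s).summable]
  refine tsum_congr fun j => ?_
  rw [map_add, add_mul]

/-- A series of polynomials with geometrically decreasing coefficients is a power series. -/
lemma hasSum_of_polynomials [IsUltrametricDist K] {D : ℝ} (c : ℕ → ℕ → K)
    (hc : ∀ n j, n < j → c n j = 0) (hD : ∀ n j, ‖c n j‖ ≤ D * rad p ^ n) :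
    IsBdd p D (PowerSeries.mk fun j => ∑' n, c n j) ∧ ∀ s : ℤ_[p],
      HasSum (fun n => ∑ j ∈ Finset.range (n + 1), c n j * emb K s ^ j)
        (ev (PowerSeries.mk fun j => ∑' n, c n j) s) := by
  have hr := rad_pos p
  have hD0 : 0 ≤ D := by simpa using (norm_nonneg _).trans (hD 0 0)
  refine ⟨fun j => ?_, fun s => ?_⟩
  · rw [coeff_mk]
    refine IsUltrametricDist.norm_tsum_le_of_forall_le_of_nonneg (by positivity) fun n => ?_
    rcases lt_or_ge n j with h | h
    · rw [hc n j h, norm_zero]; positivity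
    · exact (hD n j).trans (mul_le_mul_of_nonneg_left
        (pow_le_pow_of_le_one hr.le (rad_lt_one p).le h) hD0)
  -- For j ≤ n one has `rad p ^ n` = q^n q^n ≤ q^n q^j, which is summable over pairs and allows
  -- exchanging the two sums.
  · set q := √(rad p) with hq
    have hq0 : 0 < q := Real.sqrt_pos.2 hr
    have hq2 : q ^ 2 = rad p := Real.sq_sqrt hr.le
    have hq1 : q < 1 := (sq_lt_one_iff₀ hq0.le).1 (hq2 ▸ rad_lt_one p)
    have hqs := summable_geometric_of_lt_one hq0.le hq1
    have hsum : Summable (Function.uncurry fun n j => c n j * emb K s ^ j) := by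
      refine Summable.of_norm_bounded (g := fun x : ℕ × ℕ => D * (q ^ x.1 * q ^ x.2))
        ((hqs.mul_of_nonneg hqs (fun _ => by positivity) fun _ => by positivity).mul_left D) ?_
      rintro ⟨n, j⟩
      simp only [Function.uncurry]
      rcases lt_or_ge n j with h | h
      · rw [hc n j h, zero_mul, norm_zero]; positivity
      · rw [norm_mul, norm_pow, norm_emb]
        refine (mul_le_of_le_one_right (norm_nonneg _)
          (pow_le_one₀ (norm_nonneg _) (PadicInt.norm_le_one s))).trans ((hD n j).trans ?_)
        rw [← hq2, ← pow_mul, ← pow_add]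
        exact mul_le_mul_of_nonneg_left (pow_le_pow_of_le_one hq0.le hq1.le (by omega)) hD0
    have h1 : ev (PowerSeries.mk fun j => ∑' n, c n j) s
        = ∑' x : ℕ × ℕ, Function.uncurry (fun n j => c n j * emb K s ^ j) x := by
      rw [hsum.tsum_prod]
      change _ = ∑' (n : ℕ) (j : ℕ), c n j * emb K s ^ j
      rw [hsum.tsum_comm.symm]
      unfold ev
      refine tsum_congr fun j => ?_
      rw [coeff_mk, tsum_mul_right]
    rw [h1]
    refine hsum.hasSum.prod_fiberwise fun n => ?_
    refine hasSum_sum_of_ne_finset_zero fun j hj => ?_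
    simp only [Function.uncurry]
    rw [hc n j (by simpa using hj), zero_mul]

/-- Substitution of `1 - s` into a power series. -/
lemma IsBdd.exists_one_sub [IsUltrametricDist K] {D : ℝ} {f : K⟦X⟧} (hf : IsBdd p D f) :
    ∃ g : K⟦X⟧, IsBdd p D g ∧ ∀ s : ℤ_[p], ev g s = ev f (1 - s) := by
  have hr := rad_pos p
  have hD := hf.nonneg
  obtain ⟨h1, h2⟩ := hasSum_of_polynomials (p := p) (D := D)
    (fun n j => coeff n f * (((-1) ^ j * n.choose j : ℤ) : K))
    (fun n j h => by simp [Nat.choose_eq_zero_of_lt h])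
    (fun n j => by
      rw [norm_mul]
      exact (mul_le_of_le_one_right (norm_nonneg _) (norm_intCast_le_one p K _)).trans (hf n))
  refine ⟨_, h1, fun s => (h2 s).unique ?_⟩
  convert hf.hasSum (1 - s) using 2 with n
  rw [map_sub, map_one, sub_eq_neg_add, add_pow, Finset.mul_sum]
  refine Finset.sum_congr rfl fun j _ => ?_
  push_cast
  rw [neg_pow (emb K s) j]
  ring

end PowerSeries

/-! ### Roots of unity close to 1 -/

section RootsOfUnity

lemma norm_eq_one_of_pow_eq_one {K : Type*} [NormedField K] {z : K} {n : ℕ} (hn : n ≠ 0) (hz : z ^ n = 1) : ‖z‖ = 1 := by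
  rw [← pow_eq_one_iff_of_nonneg (norm_nonneg _) hn, ← norm_pow, hz, norm_one]

variable {p : ℕ} [hp : Fact p.Prime] {K : Type*} [NormedField K] [NormedAlgebra ℚ_[p] K]
  [IsUltrametricDist K]

/-- With x = z - 1 ≠ 0, dividing (1 + x)^q = 1 by x leaves q plus terms divisible by x. For q ≠ p
these are smaller than |q| = 1. For q = p the middle binomials contain p, and the last term has norm
at most |x|² < |p|. -/
lemma eq_one_of_pow_prime_eq_one (hp2 : 2 < p) {q : ℕ} (hq : q.Prime) {z : K} (hz : z ^ q = 1)
    (h : ‖z - 1‖ < rad p) : z = 1 := by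
  by_contra hne
  set x := z - 1 with hx
  have hx0 : x ≠ 0 := sub_ne_zero.2 hne
  have hr1 := rad_lt_one p
  have hxx : ‖x‖ ^ 2 < (p : ℝ)⁻¹ := by
    rw [← rad_sq]; exact pow_lt_pow_left₀ h (norm_nonneg _) two_ne_zero
  obtain ⟨r, rfl⟩ : ∃ r, q = r + 1 := ⟨q - 1, by have := hq.pos; omega⟩
  have h1 : x * (((r + 1 : ℕ) : K)
      + ∑ i ∈ Finset.range r, x ^ (i + 1) * ((r + 1).choose (i + 2) : K)) = 0 := by
    have h2 : (x + 1) ^ (r + 1) = 1 := by rw [hx, sub_add_cancel, hz]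
    rw [add_pow, Finset.sum_range_succ', Finset.sum_range_succ'] at h2
    simp only [one_pow, mul_one, pow_zero, Nat.choose_zero_right, Nat.cast_one, zero_add,
      Nat.choose_one_right, add_eq_right] at h2
    rw [← h2, mul_add, Finset.mul_sum, add_comm]
    congr 1
    · refine Finset.sum_congr rfl fun i _ => ?_
      ring
    · ring
  have h3 := (mul_eq_zero.1 h1).resolve_left hx0
  have h4 : ‖((r + 1 : ℕ) : K)‖
      = ‖∑ i ∈ Finset.range r, x ^ (i + 1) * ((r + 1).choose (i + 2) : K)‖ := by
    rw [eq_neg_of_add_eq_zero_left h3, norm_neg]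
  by_cases hqp : r + 1 = p
  · have hp0 : (0 : ℝ) < (p : ℝ)⁻¹ := inv_pos.2 (by exact_mod_cast hp.1.pos)
    rw [hqp, norm_prime p K] at h4
    have hlt : max ((p : ℝ)⁻¹ * ‖x‖) (‖x‖ ^ 2) < (p : ℝ)⁻¹ :=
      max_lt (mul_lt_of_lt_one_right hp0 (h.trans hr1)) hxx
    refine absurd (h4.le.trans (IsUltrametricDist.norm_sum_le_of_forall_le_of_nonneg
      (by positivity) fun i hi => ?_)) (not_le.2 hlt)
    rw [Finset.mem_range] at hi
    rw [norm_mul, norm_pow]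
    have hx1 : ‖x‖ ≤ 1 := (h.trans hr1).le
    rcases Nat.lt_or_ge (i + 2) p with h5 | h5
    · refine le_max_of_le_left ?_
      obtain ⟨c, hc⟩ := hp.1.dvd_choose_self (k := i + 2) (by omega) h5
      rw [hc, Nat.cast_mul, norm_mul, norm_prime p K]
      calc ‖x‖ ^ (i + 1) * ((p : ℝ)⁻¹ * ‖(c : K)‖) ≤ ‖x‖ ^ 1 * ((p : ℝ)⁻¹ * 1) := by
            gcongr ?_ * (_ * ?_)
            · exact pow_le_pow_of_le_one (norm_nonneg _) hx1 (by omega)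
            · exact norm_natCast_le_one p K _
        _ = _ := by ring
    · refine le_max_of_le_right ?_
      exact (mul_le_of_le_one_right (by positivity) (norm_natCast_le_one p K _)).trans
        (pow_le_pow_of_le_one (norm_nonneg _) hx1 (by omega))
  · rw [norm_natCast_eq_one p K fun hd => hqp ((Nat.prime_dvd_prime_iff_eq hp.1 hq).1 hd).symm] at h4
    refine absurd (h4.le.trans (IsUltrametricDist.norm_sum_le_of_forall_le_of_nonneg
      (norm_nonneg x) fun i _ => ?_)) (not_le.2 (h.trans hr1))
    rw [norm_mul, norm_pow]
    refine (mul_le_of_le_one_right (by positivity) (norm_natCast_le_one p K _)).trans ?_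
    exact pow_le_of_le_one (norm_nonneg _) (h.trans hr1).le (by omega)

lemma norm_pow_sub_one_le {z : K} (hz : ‖z‖ ≤ 1) (n : ℕ) : ‖z ^ n - 1‖ ≤ ‖z - 1‖ := by
  rw [← mul_geom_sum, norm_mul]
  refine mul_le_of_le_one_right (norm_nonneg _) ?_
  refine IsUltrametricDist.norm_sum_le_of_forall_le_of_nonneg zero_le_one fun i _ => ?_
  rw [norm_pow]; exact pow_le_one₀ (norm_nonneg _) hz

/-- Prime factors of n are stripped one at a time, powers of z staying as close to 1 as z. -/
lemma eq_one_of_pow_eq_one (hp2 : 2 < p) {n : ℕ} (hn : n ≠ 0) {z : K} (hz : z ^ n = 1)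
    (h : ‖z - 1‖ < rad p) : z = 1 := by
  induction n using induction_on_primes generalizing z with
  | zero => exact absurd rfl hn
  | one => simpa using hz
  | prime_mul q a hq ih =>
    have ha : a ≠ 0 := by rintro rfl; simp at hn
    refine eq_one_of_pow_prime_eq_one hp2 hq (ih ha (by rw [← pow_mul, hz]) ?_) h
    exact (norm_pow_sub_one_le (norm_eq_one_of_pow_eq_one hn hz).le q).trans_lt h

end RootsOfUnity

/-! ### The function s ↦ u^s -/

section OnePow

variable {p : ℕ} [hp : Fact p.Prime]

lemma tendsto_sub_one_pow {u : ℤ_[p]} (hu : ‖u - 1‖ < 1) :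
    Tendsto (fun n : ℕ => (u - 1) ^ n) atTop (𝓝 0) :=
  tendsto_pow_atTop_nhds_zero_iff_norm_lt_one.2 hu

lemma onePow_add {u : ℤ_[p]} (hu : ‖u - 1‖ < 1) (s t : ℤ_[p]) :
    onePow u (s + t) = onePow u s * onePow u t := by
  simp only [onePow_eq_addChar (tendsto_sub_one_pow hu), AddChar.map_add_eq_mul]

lemma onePow_natCast {u : ℤ_[p]} (hu : ‖u - 1‖ < 1) (n : ℕ) : onePow u (n : ℤ_[p]) = u ^ n := by
  rw [onePow_eq_addChar (tendsto_sub_one_pow hu), ← nsmul_one, AddChar.map_nsmul_eq_pow,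
    PadicInt.addChar_of_value_at_one_def, add_sub_cancel]

lemma onePow_sub_one_mul {u : ℤ_[p]} (hu : ‖u - 1‖ < 1) (t : ℤ_[p]) :
    onePow u (t - 1) * u = onePow u t := by
  have h := onePow_add hu (t - 1) 1
  rw [sub_add_cancel] at h
  have h1 := onePow_natCast hu 1
  rw [Nat.cast_one, pow_one] at h1
  rw [h, h1]

lemma hasSum_onePow (K : Type*) [NormedField K] [NormedAlgebra ℚ_[p] K] {u : ℤ_[p]}
    (hu : ‖u - 1‖ < 1) (t : ℤ_[p]) :
    HasSum (fun n => emb K (mahler n t) * emb K (u - 1) ^ n) (emb K (onePow u t)) := by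
  have h1 : HasSum (fun n => mahler n t * (u - 1) ^ n) (onePow u t) := by
    have hs : Summable fun n => mahler n t * (u - 1) ^ n := by
      refine Summable.of_norm_bounded (summable_geometric_of_lt_one (norm_nonneg _) hu) fun n => ?_
      rw [norm_mul, norm_pow]
      exact mul_le_of_le_one_left (by positivity) (PadicInt.norm_le_one _)
    have h2 := PadicInt.mahlerSeries_apply (E := ℤ_[p]) (tendsto_sub_one_pow hu) t
    simp only [smul_eq_mul] at h2
    rw [onePow, h2]
    exact hs.hasSum
  have h3 := h1.map (emb K) (continuous_emb K)
  simpa [Function.comp_def] using h3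

/-- The valuation on ℤ_p is discrete. -/
lemma norm_sub_one_le {u : ℤ_[p]} (hu : ‖u - 1‖ < 1) : ‖u - 1‖ ≤ (p : ℝ)⁻¹ := by
  have := (PadicInt.norm_le_pow_iff_norm_lt_pow_add_one (u - 1) (-1)).2 (by simpa using hu)
  simpa using this

end OnePow

/-! ### From Mahler series to power series -/

section Mahler

open PowerSeries

variable {p : ℕ} [hp : Fact p.Prime] (K : Type*) [NormedField K] [NormedAlgebra ℚ_[p] K]

/-- The coefficients of the binomial polynomials. -/
def chooseCoeff (K : Type*) [NormedField K] (n j : ℕ) : K :=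
  ((descPochhammer ℤ n).coeff j : K) / (n.factorial : K)

lemma chooseCoeff_of_lt {n j : ℕ} (h : n < j) : chooseCoeff K n j = 0 := by
  rw [chooseCoeff, Polynomial.coeff_eq_zero_of_natDegree_lt
    (by rwa [descPochhammer_natDegree]), Int.cast_zero, zero_div]

lemma chooseCoeff_zero_zero : chooseCoeff K 0 0 = 1 := by simp [chooseCoeff]

lemma chooseCoeff_zero_right {n : ℕ} (hn : n ≠ 0) : chooseCoeff K n 0 = 0 := by
  rw [chooseCoeff, Polynomial.coeff_zero_eq_eval_zero, descPochhammer_ne_zero_eval_zero ℤ hn,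
    Int.cast_zero, zero_div]

lemma chooseCoeff_one_one : chooseCoeff K 1 1 = 1 := by simp [chooseCoeff]

lemma norm_chooseCoeff_le (hp2 : 2 < p) {n : ℕ} (hn : n ≠ 0) (j : ℕ) :
    ‖chooseCoeff K n j‖ * rad p ^ (n - 1) ≤ 1 := by
  have h := rad_pow_le_norm_factorial (p := p) K hp2 hn
  have hr : 0 < rad p ^ (n - 1) := pow_pos (rad_pos p) _
  rw [chooseCoeff, norm_div, div_mul_eq_mul_div, div_le_one (hr.trans_le h)]
  exact (mul_le_of_le_one_left hr.le (norm_intCast_le_one p K _)).trans h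

lemma emb_mahler (n : ℕ) (t : ℤ_[p]) :
    emb K (mahler n t) = ∑ j ∈ Finset.range (n + 1), chooseCoeff K n j * emb K t ^ j := by
  have : CharZero K := (RingHom.charZero_iff (algebraMap ℚ_[p] K).injective).1 inferInstance
  have hf : (n.factorial : K) ≠ 0 := by exact_mod_cast n.factorial_ne_zero
  have h1 := Ring.descPochhammer_eq_factorial_smul_choose t n
  rw [← Polynomial.aeval_eq_smeval] at h1
  apply_fun emb K at h1
  rw [Polynomial.aeval_def, Polynomial.hom_eval₂, Polynomial.eval₂_eq_sum_range,
    descPochhammer_natDegree, nsmul_eq_mul, map_mul, map_natCast] at h1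
  rw [mahler_apply, eq_div_of_mul_eq hf ((mul_comm _ _).trans h1.symm), Finset.sum_div]
  refine Finset.sum_congr rfl fun j _ => ?_
  rw [chooseCoeff]
  simp
  ring

variable {K} [IsUltrametricDist K] [CompleteSpace K]

/-- A Mahler series with coefficients `O(p^{-n})` is a power series. -/
lemma exists_hasSum_mahler (hp2 : 2 < p) {D : ℝ} {d : ℕ → K}
    (hd : ∀ n, ‖d n‖ ≤ D * (p : ℝ)⁻¹ ^ n) :
    ∃ f : K⟦X⟧, IsBdd p D f ∧ coeff 0 f = d 0 ∧
      ∀ t : ℤ_[p], HasSum (fun n => emb K (mahler n t) * d n) (ev f t) := by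
  have hr := rad_pos p
  have hD : 0 ≤ D := by simpa using (norm_nonneg _).trans (hd 0)
  obtain ⟨h1, h2⟩ := hasSum_of_polynomials (p := p) (D := D)
    (fun n j => d n * chooseCoeff K n j)
    (fun n j h => by simp [chooseCoeff_of_lt K h])
    (fun n j => by
      rw [norm_mul]
      rcases eq_or_ne n 0 with rfl | hn
      · rcases eq_or_ne j 0 with rfl | hj
        · simpa [chooseCoeff_zero_zero] using hd 0
        · rw [chooseCoeff_of_lt K (Nat.pos_of_ne_zero hj)]; simpa using hD
      · have h3 := norm_chooseCoeff_le K hp2 hn j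
        have h4 : rad p ^ n ≤ rad p ^ (n - 1) :=
          pow_le_pow_of_le_one hr.le (rad_lt_one p).le (by omega)
        -- Of the two factors in p^{-n} = `rad p ^ n * rad p ^ n`, one absorbs the denominator n!
        -- and the other is the remaining decay.
        calc ‖d n‖ * ‖chooseCoeff K n j‖
            ≤ (D * (rad p ^ n * rad p ^ n)) * ‖chooseCoeff K n j‖ := by
              refine mul_le_mul_of_nonneg_right ((hd n).trans (le_of_eq ?_)) (norm_nonneg _)
              rw [← rad_sq]; ring
          _ = D * rad p ^ n * (‖chooseCoeff K n j‖ * rad p ^ n) := by ring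
          _ ≤ D * rad p ^ n * 1 := by
              refine mul_le_mul_of_nonneg_left (le_trans ?_ h3) (by positivity)
              exact mul_le_mul_of_nonneg_left h4 (norm_nonneg _)
          _ = _ := mul_one _)
  refine ⟨_, h1, ?_, fun t => ?_⟩
  · rw [coeff_mk, tsum_eq_single 0 fun n hn => by rw [chooseCoeff_zero_right K hn, mul_zero],
      chooseCoeff_zero_zero, mul_one]
  · convert h2 t using 2 with n
    rw [emb_mahler, Finset.sum_mul]
    exact Finset.sum_congr rfl fun j _ => by ring

/-- The power series of `t ↦ u ^ t`. -/
lemma exists_powerSeries_onePow (hp2 : 2 < p) {u : ℤ_[p]} (hu : ‖u - 1‖ < 1) :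
    ∃ f : K⟦X⟧, IsBdd p 1 f ∧ coeff 0 f = 1 ∧
      (∀ j, ‖coeff (j + 1) f‖ ≤ ‖u - 1‖ * rad p ^ j) ∧ ‖coeff 1 f‖ = ‖u - 1‖ ∧
      ∀ t : ℤ_[p], ev f t = emb K (onePow u t) := by
  have hr := rad_pos p
  have hr1 := rad_lt_one p
  set x : K := emb K (u - 1) with hx
  have hxn : ‖x‖ = ‖u - 1‖ := norm_emb K _
  have hxp : ‖x‖ ≤ rad p ^ 2 := by rw [hxn, rad_sq]; exact norm_sub_one_le hu
  -- One factor x is kept outside: the nonconstant coefficients must be bounded relative to |u - 1|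
  -- itself.
  have hb : ∀ n j, ‖x ^ (n + 1) * chooseCoeff K (n + 1) j‖ ≤ ‖x‖ * rad p ^ n := fun n j => by
    have h3 := norm_chooseCoeff_le K hp2 n.succ_ne_zero j
    rw [Nat.succ_sub_one] at h3
    have h4 : ‖x‖ ^ n ≤ rad p ^ n * rad p ^ n := by
      rw [← pow_add, ← two_mul, pow_mul]; exact pow_le_pow_left₀ (norm_nonneg _) hxp n
    rw [norm_mul, norm_pow, pow_succ]
    calc ‖x‖ ^ n * ‖x‖ * ‖chooseCoeff K (n + 1) j‖
        ≤ rad p ^ n * rad p ^ n * ‖x‖ * ‖chooseCoeff K (n + 1) j‖ := by gcongr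
      _ = ‖x‖ * rad p ^ n * (‖chooseCoeff K (n + 1) j‖ * rad p ^ n) := by ring
      _ ≤ ‖x‖ * rad p ^ n * 1 := by gcongr
      _ = _ := mul_one _
  have hle : ∀ n j, ‖x ^ n * chooseCoeff K n j‖ ≤ 1 * rad p ^ n := by
    rintro (_ | n) j
    · rcases eq_or_ne j 0 with rfl | hj
      · simp [chooseCoeff_zero_zero]
      · rw [chooseCoeff_of_lt K (Nat.pos_of_ne_zero hj)]; simp
    · refine (hb n j).trans ?_
      rw [one_mul, pow_succ']
      refine mul_le_mul_of_nonneg_right (hxp.trans ?_) (by positivity)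
      exact pow_le_of_le_one hr.le hr1.le two_ne_zero
  obtain ⟨h1, h2⟩ := hasSum_of_polynomials (p := p) (D := 1)
    (fun n j => x ^ n * chooseCoeff K n j)
    (fun n j h => by simp [chooseCoeff_of_lt K h]) hle
  have hj : ∀ j, ‖∑' n, x ^ n * chooseCoeff K n (j + 1)‖ ≤ ‖x‖ * rad p ^ j := fun j => by
    refine IsUltrametricDist.norm_tsum_le_of_forall_le_of_nonneg (by positivity) fun n => ?_
    rcases lt_or_ge n (j + 1) with h | h
    · rw [chooseCoeff_of_lt K h, mul_zero, norm_zero]; positivity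
    · obtain ⟨m, rfl⟩ := Nat.exists_eq_add_of_le h
      rw [show j + 1 + m = j + m + 1 by ring]
      refine (hb _ _).trans (mul_le_mul_of_nonneg_left ?_ (norm_nonneg _))
      exact pow_le_pow_of_le_one hr.le hr1.le (by omega)
  refine ⟨_, h1, ?_, fun j => ?_, ?_, fun t => ?_⟩
  · rw [coeff_mk, tsum_eq_single 0 fun n hn => by rw [chooseCoeff_zero_right K hn, mul_zero],
      chooseCoeff_zero_zero, pow_zero, mul_one]
  · rw [coeff_mk, ← hxn]; exact hj j
  · rw [coeff_mk, ← hxn]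
    have hs : Summable fun n => x ^ n * chooseCoeff K n 1 :=
      Summable.of_norm_bounded (summable_rad p 1) fun n => hle n 1
    rcases eq_or_ne x 0 with h0 | h0
    · rw [h0]
      refine norm_eq_zero.2 ?_ |>.trans norm_zero.symm
      refine (tsum_congr fun n => ?_).trans tsum_zero
      rcases eq_or_ne n 0 with rfl | hn
      · rw [chooseCoeff_of_lt K one_pos, mul_zero]
      · rw [zero_pow hn, zero_mul]
    · rw [hs.tsum_eq_add_tsum_ite 1, chooseCoeff_one_one, pow_one, mul_one]
      -- The linear coefficient is x plus strictly smaller terms, as for log(1 + x).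
      have hlt : ‖∑' n, if n = 1 then 0 else x ^ n * chooseCoeff K n 1‖ < ‖x‖ := by
        refine lt_of_le_of_lt (IsUltrametricDist.norm_tsum_le_of_forall_le_of_nonneg
          (C := ‖x‖ * rad p) (by positivity) fun n => ?_)
          (mul_lt_of_lt_one_right (norm_pos_iff.2 h0) hr1)
        split_ifs with hn
        · rw [norm_zero]; positivity
        · rcases eq_or_ne n 0 with rfl | hn'
          · rw [chooseCoeff_of_lt K one_pos, mul_zero, norm_zero]; positivity
          · obtain ⟨m, rfl⟩ : ∃ m, n = m + 1 + 1 := ⟨n - 2, by omega⟩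
            refine (hb _ _).trans (mul_le_mul_of_nonneg_left ?_ (norm_nonneg _))
            exact pow_le_of_le_one hr.le hr1.le m.succ_ne_zero
      rw [IsUltrametricDist.norm_add_eq_max_of_norm_ne_norm hlt.ne', max_eq_left hlt.le]
  · refine (h2 t).unique ?_
    convert hasSum_onePow K hu t using 2 with n
    rw [emb_mahler, Finset.sum_mul]
    exact Finset.sum_congr rfl fun j _ => by ring

/-- `1 - z u ^ t` is invertible if `z` is far from `1`. -/
lemma exists_mul_one_sub_eq_one (hp2 : 2 < p) {u : ℤ_[p]} (hu : ‖u - 1‖ < 1) {z : K}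
    (hz : ‖z‖ ≤ 1) (hz1 : rad p ≤ ‖z - 1‖) :
    ∃ (D : ℝ) (h : K⟦X⟧), IsBdd p D h ∧
      ∀ t : ℤ_[p], ev h t * (1 - z * emb K (onePow u t)) = 1 := by
  have hr := rad_pos p
  have hr1 := rad_lt_one p
  obtain ⟨f, hf, hf0, hfj, -, hft⟩ := exists_powerSeries_onePow (K := K) hp2 hu
  have hn0 : 1 - z ≠ 0 := by
    intro h
    rw [← norm_neg, neg_sub, h, norm_zero] at hz1
    linarith
  set a := (1 - z)⁻¹ with ha
  have han : ‖a‖ ≤ (rad p)⁻¹ := by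
    rw [ha, norm_inv, norm_sub_rev]; exact inv_anti₀ hr hz1
  -- G = (1 - z f) / (1 - z) has constant term 1. The division costs at most one factor `(rad p)⁻¹`,
  -- while the higher coefficients of f have a factor |u - 1| ≤ `rad p ^ 2` to spare.
  set G : K⟦X⟧ := C a + C (-(a * z)) * f with hG
  have hGb : IsBdd p 1 G := by
    rintro (_ | j)
    · rw [hG, map_add, coeff_C_mul, hf0, coeff_zero_C, mul_one, ← sub_eq_add_neg,
        ← mul_one_sub, ha, inv_mul_cancel₀ hn0]
      simp
    · rw [hG, map_add, coeff_C_mul, coeff_C, if_neg j.succ_ne_zero, zero_add, norm_mul, norm_neg,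
        norm_mul, one_mul]
      calc ‖a‖ * ‖z‖ * ‖coeff (j + 1) f‖
          ≤ (rad p)⁻¹ * 1 * (rad p ^ 2 * rad p ^ j) := by
            gcongr
            refine (hfj j).trans ?_
            rw [rad_sq]
            exact mul_le_mul_of_nonneg_right (norm_sub_one_le hu) (by positivity)
        _ = _ := by field_simp; ring
  have hG0 : coeff 0 G = 1 := by
    rw [hG, map_add, coeff_C_mul, hf0, coeff_zero_C, mul_one, ← sub_eq_add_neg,
        ← mul_one_sub, ha, inv_mul_cancel₀ hn0]
  have hGi := hGb.inv (by rw [hG0, norm_one])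
  refine ⟨_, _, (isBdd_C a).mul hGi, fun t => ?_⟩
  have h1 : ev G t = a * (1 - z * emb K (onePow u t)) := by
    rw [hG, ev_add (isBdd_C a) ((isBdd_C _).mul hf), ev_C, ev_mul (isBdd_C _) hf, ev_C, hft]
    ring
  have h2 : ev G t * ev G⁻¹ t = 1 := by
    rw [← ev_mul hGb hGi, PowerSeries.mul_inv_cancel, ← map_one C, ev_C]
    rw [← coeff_zero_eq_constantCoeff_apply, hG0]; exact one_ne_zero
  rw [ev_mul (isBdd_C _) hGi, ev_C, mul_right_comm, ← h1, h2]

/-- `1 - u ^ t` is `t` times a unit if `u ≠ 1`. -/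
lemma exists_mul_one_sub_eq_self (hp2 : 2 < p) {u : ℤ_[p]} (hu : ‖u - 1‖ < 1) (hu1 : u ≠ 1) :
    ∃ (D : ℝ) (h : K⟦X⟧), IsBdd p D h ∧ (∀ t : ℤ_[p], ev h t ≠ 0) ∧
      ∀ t : ℤ_[p], ev h t * (1 - emb K (onePow u t)) = emb K t := by
  have hr := rad_pos p
  obtain ⟨f, hf, hf0, hfj, hf1, hft⟩ := exists_powerSeries_onePow (K := K) hp2 hu
  have hx : ‖u - 1‖ ≠ 0 := norm_ne_zero_iff.2 (sub_ne_zero.2 hu1)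
  set a := (coeff 1 f)⁻¹ with ha
  have hc1 : coeff 1 f ≠ 0 := by rw [← norm_ne_zero_iff, hf1]; exact hx
  have han : ‖a‖ = ‖u - 1‖⁻¹ := by rw [ha, norm_inv, hf1]
  -- G is (f - 1) / X divided by the linear coefficient of f. It is invertible with constant term 1,
  -- and h is G⁻¹ times -a.
  set G : K⟦X⟧ := PowerSeries.mk fun j => a * coeff (j + 1) f with hG
  have hGb : IsBdd p 1 G := fun j => by
    rw [hG, coeff_mk, norm_mul, han, one_mul, inv_mul_le_iff₀ (lt_of_le_of_ne (norm_nonneg _) hx.symm)]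
    exact hfj j
  have hG0 : coeff 0 G = 1 := by rw [hG, coeff_mk, ha, inv_mul_cancel₀ hc1]
  have hGi := hGb.inv (by rw [hG0, norm_one])
  have hX : IsBdd p (rad p)⁻¹ (X : K⟦X⟧) := fun j => by
    rw [coeff_X]
    split_ifs with h
    · rw [h, norm_one, pow_one, inv_mul_cancel₀ hr.ne']
    · rw [norm_zero]; positivity
  have hfX : f = C 1 + X * (C (coeff 1 f) * G) := by
    ext j
    rcases j with _ | j
    · simp [hf0]
    · rw [map_add, coeff_C, if_neg j.succ_ne_zero, zero_add, coeff_succ_X_mul, coeff_C_mul, hG,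
        coeff_mk, ha, mul_inv_cancel_left₀ hc1]
  have h2 : ∀ t : ℤ_[p], ev G t * ev G⁻¹ t = 1 := fun t => by
    rw [← ev_mul hGb hGi, PowerSeries.mul_inv_cancel, ← map_one C, ev_C]
    rw [← coeff_zero_eq_constantCoeff_apply, hG0]; exact one_ne_zero
  refine ⟨_, _, (isBdd_C (-a)).mul hGi, fun t => ?_, fun t => ?_⟩
  · rw [ev_mul (isBdd_C _) hGi, ev_C]
    exact mul_ne_zero (neg_ne_zero.2 (inv_ne_zero hc1)) (right_ne_zero_of_mul_eq_one (h2 t))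
  · rw [ev_mul (isBdd_C _) hGi, ev_C, ← hft, hfX, ev_add (isBdd_C 1) (hX.mul ((isBdd_C _).mul hGb)),
      ev_C, ev_mul hX ((isBdd_C _).mul hGb), ev_X, ev_mul (isBdd_C _) hGb, ev_C]
    calc _ = emb K t * (a * coeff 1 f) * (ev G t * ev G⁻¹ t) := by ring
      _ = _ := by rw [h2, ha, inv_mul_cancel₀ hc1, mul_one, mul_one]

end Mahler

/-! ### Finite sums: blocks, doubling and alternating signs -/

section Sums

variable {A : Type*} [AddCommMonoid A]

lemma sum_range_mul_eq (g : ℕ → A) (N L : ℕ) :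
    ∑ a ∈ Finset.range (N * L), g a
      = ∑ j ∈ Finset.range L, ∑ a ∈ Finset.range N, g (a + N * j) := by
  induction L with
  | zero => simp
  | succ L ih =>
    rw [Nat.mul_succ, Finset.sum_range_add, ih, Finset.sum_range_succ]
    simp only [add_comm]

lemma sum_range_two_mul_add_one (g : ℕ → A) (M : ℕ) :
    ∑ a ∈ Finset.range (2 * M + 1), g a
      = ∑ i ∈ Finset.range (M + 1), g (2 * i) + ∑ i ∈ Finset.range M, g (2 * i + 1) := by
  induction M with
  | zero => simp
  | succ M ih =>
    rw [show 2 * (M + 1) + 1 = 2 * M + 1 + 1 + 1 by ring, Finset.sum_range_succ,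
      Finset.sum_range_succ, ih, Finset.sum_range_succ _ (M + 1),
      Finset.sum_range_succ (fun i => g (2 * i + 1)) M, show 2 * (M + 1) = 2 * M + 1 + 1 by ring]
    generalize g (2 * M + 1 + 1) = x
    generalize g (2 * M + 1) = y
    generalize ∑ i ∈ Finset.range M, g (2 * i + 1) = z
    ac_rfl

/-- The sum of `f` over the even numbers below `2 (2 M + 1)`. -/
lemma sum_range_double {A : Type*} [AddCommGroup A] (f : ℕ → A) (M : ℕ) :
    ∑ a ∈ Finset.range (2 * M + 1), f (2 * a) = ∑ a ∈ Finset.range (2 * M + 1), f a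
      + ∑ i ∈ Finset.range M, (f (2 * i + 1 + (2 * M + 1)) - f (2 * i + 1)) := by
  rw [Finset.sum_sub_distrib, sum_range_two_mul_add_one f,
    show 2 * M + 1 = M + 1 + M by ring, Finset.sum_range_add]
  -- Even numbers beyond the modulus 2M + 1 are odd numbers shifted by it: 2(M + 1 + i) = (2i + 1) +
  -- (2M + 1).
  rw [show ∑ i ∈ Finset.range M, f (2 * i + 1 + (M + 1 + M))
    = ∑ i ∈ Finset.range M, f (2 * (M + 1 + i)) from
    Finset.sum_congr rfl fun i _ => by congr 1; ring]
  abel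

lemma sum_range_alternating {R : Type*} [CommRing R] (f : ℕ → R) (M : ℕ) :
    ∑ a ∈ Finset.range (2 * M + 1), (-1) ^ a * f a
      = ∑ a ∈ Finset.range (2 * M + 1), f a - 2 * ∑ i ∈ Finset.range M, f (2 * i + 1) := by
  rw [sum_range_two_mul_add_one, sum_range_two_mul_add_one f]
  simp only [pow_add, pow_mul, neg_one_sq, one_pow, one_mul, pow_one, neg_mul,
    Finset.sum_neg_distrib]
  ring

end Sums

/-! ### Sums of p-adically Lipschitz functions -/

section Lipschitz

variable {p : ℕ} [hp : Fact p.Prime] {K : Type*} [NormedField K]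

/-- Functions bounded by one and `1`-Lipschitz for the `p`-adic distance on small scales. -/
def IsLip (p M : ℕ) (F : ℕ → K) : Prop :=
  (∀ a, ‖F a‖ ≤ 1) ∧ ∀ n, M ≤ n → ∀ a b, ‖F (a + p ^ n * b) - F a‖ ≤ (p : ℝ)⁻¹ ^ n

lemma inv_prime_pos (p : ℕ) [hp : Fact p.Prime] : 0 < (p : ℝ)⁻¹ :=
  inv_pos.2 (by exact_mod_cast hp.1.pos)

lemma inv_prime_lt_one (p : ℕ) [hp : Fact p.Prime] : (p : ℝ)⁻¹ < 1 :=
  inv_lt_one_of_one_lt₀ (by exact_mod_cast hp.1.one_lt)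

lemma IsLip.mono {M M' : ℕ} {F : ℕ → K} (hF : IsLip p M F) (h : M ≤ M') : IsLip p M' F :=
  ⟨hF.1, fun n hn => hF.2 n (h.trans hn)⟩

variable [IsUltrametricDist K]

lemma norm_sub_le_max' (x y : K) : ‖x - y‖ ≤ max ‖x‖ ‖y‖ := by
  rw [sub_eq_add_neg, ← norm_neg y]; exact IsUltrametricDist.norm_add_le_max _ _

lemma IsLip.mul {M : ℕ} {F G : ℕ → K} (hF : IsLip p M F) (hG : IsLip p M G) :
    IsLip p M fun a => F a * G a := by
  refine ⟨fun a => ?_, fun n hn a b => ?_⟩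
  · rw [norm_mul]; exact mul_le_one₀ (hF.1 a) (norm_nonneg _) (hG.1 a)
  · rw [show F (a + p ^ n * b) * G (a + p ^ n * b) - F a * G a
      = F (a + p ^ n * b) * (G (a + p ^ n * b) - G a) + (F (a + p ^ n * b) - F a) * G a by ring]
    refine (IsUltrametricDist.norm_add_le_max _ _).trans (max_le ?_ ?_)
    · rw [norm_mul]
      exact (mul_le_of_le_one_left (norm_nonneg _) (hF.1 _)).trans (hG.2 n hn a b)
    · rw [norm_mul]
      exact (mul_le_of_le_one_right (norm_nonneg _) (hG.1 _)).trans (hF.2 n hn a b)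

lemma isLip_const {c : K} (hc : ‖c‖ ≤ 1) (M : ℕ) : IsLip p M fun _ => c :=
  ⟨fun _ => hc, fun n _ a b => by
    rw [sub_self, norm_zero]; exact (pow_pos (inv_prime_pos p) n).le⟩

lemma IsLip.pow {M : ℕ} {F : ℕ → K} (hF : IsLip p M F) (j : ℕ) :
    IsLip p M fun a => F a ^ j := by
  induction j with
  | zero => simpa using isLip_const (p := p) (K := K) (c := 1) (by simp) M
  | succ j ih => simpa only [pow_succ] using ih.mul hF

lemma IsLip.sub_one {M : ℕ} {F : ℕ → K} (hF : IsLip p M F) : IsLip p M fun a => F a - 1 :=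
  ⟨fun a => (norm_sub_le_max' _ _).trans (max_le (hF.1 a) norm_one.le), fun n hn a b => by
    rw [sub_sub_sub_cancel_right]; exact hF.2 n hn a b⟩

lemma isLip_of_periodic {M : ℕ} {F : ℕ → K} (h1 : ∀ a, ‖F a‖ ≤ 1)
    (h2 : ∀ a b, F (a + p ^ M * b) = F a) : IsLip p M F := by
  refine ⟨h1, fun n hn a b => ?_⟩
  obtain ⟨k, rfl⟩ := Nat.exists_eq_add_of_le hn
  rw [pow_add, mul_assoc, h2, sub_self, norm_zero]
  exact (pow_pos (inv_prime_pos p) _).le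

lemma IsLip.norm_sum_le {M : ℕ} {F : ℕ → K} (hF : IsLip p M F) (s : Finset ℕ) :
    ‖∑ a ∈ s, F a‖ ≤ 1 :=
  IsUltrametricDist.norm_sum_le_of_forall_le_of_nonneg zero_le_one fun a _ => hF.1 a

variable [NormedAlgebra ℚ_[p] K]

lemma isLip_natCast : IsLip p 0 fun a => (a : K) :=
  ⟨fun a => norm_natCast_le_one p K a, fun n _ a b => by
    push_cast
    rw [add_sub_cancel_left, norm_mul, norm_pow, norm_prime p K]
    exact mul_le_of_le_one_right (pow_pos (inv_prime_pos p) n).le (norm_natCast_le_one p K b)⟩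

/-- The sums of a Lipschitz function over `0 ≤ a < p ^ n` tend to zero. -/
lemma IsLip.tendsto_sum {M : ℕ} {F : ℕ → K} (hF : IsLip p M F) :
    Tendsto (fun n => ∑ a ∈ Finset.range (p ^ n), F a) atTop (𝓝 0) := by
  have hp0 := inv_prime_pos p
  have hp1 := inv_prime_lt_one p
  -- Passing to the next power of p multiplies the sum by p, up to Lipschitz differences of size
  -- p^{-(M+k)}. The extra factor p⁻¹ on the left covers M = 0.
  have key : ∀ k, (p : ℝ)⁻¹ * ‖∑ a ∈ Finset.range (p ^ (M + k)), F a‖ ≤ (p : ℝ)⁻¹ ^ k := by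
    intro k
    induction k with
    | zero =>
      rw [pow_zero]
      exact mul_le_one₀ hp1.le (norm_nonneg _) (hF.norm_sum_le _)
    | succ k ih =>
      have h1 : ∑ a ∈ Finset.range (p ^ (M + (k + 1))), F a
          = ∑ j ∈ Finset.range p, ∑ a ∈ Finset.range (p ^ (M + k)), (F (a + p ^ (M + k) * j) - F a)
            + p * ∑ a ∈ Finset.range (p ^ (M + k)), F a := by
        rw [← add_assoc, pow_succ, sum_range_mul_eq]
        simp only [Finset.sum_sub_distrib, Finset.sum_const, Finset.card_range, nsmul_eq_mul]
        ring
      have h2 : ‖∑ a ∈ Finset.range (p ^ (M + (k + 1))), F a‖ ≤ (p : ℝ)⁻¹ ^ k := by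
        rw [h1]
        refine (IsUltrametricDist.norm_add_le_max _ _).trans (max_le ?_ ?_)
        · refine IsUltrametricDist.norm_sum_le_of_forall_le_of_nonneg (by positivity) fun j _ =>
            IsUltrametricDist.norm_sum_le_of_forall_le_of_nonneg (by positivity) fun a _ => ?_
          exact (hF.2 _ (Nat.le_add_right _ _) a j).trans
            (pow_le_pow_of_le_one hp0.le hp1.le (by omega))
        · rw [norm_mul, norm_prime p K]; exact ih
      rw [pow_succ']
      exact mul_le_mul_of_nonneg_left h2 hp0.le
  rw [← tendsto_add_atTop_iff_nat M]
  have h3 : Tendsto (fun k => (p : ℝ) * (p : ℝ)⁻¹ ^ k) atTop (𝓝 0) := by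
    simpa using (tendsto_pow_atTop_nhds_zero_of_lt_one hp0.le hp1).const_mul (p : ℝ)
  refine squeeze_zero_norm (fun k => ?_) h3
  have := key k
  rw [inv_mul_le_iff₀ (by exact_mod_cast hp.1.pos)] at this
  rwa [add_comm k M]

variable [CompleteSpace K]

/-- The alternating sums of a Lipschitz function over `0 ≤ a < p ^ n` converge. -/
lemma IsLip.exists_tendsto_alternating (hp2 : 2 < p) {M : ℕ} {F : ℕ → K} (hF : IsLip p M F) :
    ∃ l : K, Tendsto (fun n => ∑ a ∈ Finset.range (p ^ n), (-1) ^ a * F a) atTop (𝓝 l) := by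
  have hp0 := inv_prime_pos p
  have hodd : Odd p := hp.1.odd_of_ne_two hp2.ne'
  have h1 : ∀ n, M ≤ n → ‖∑ a ∈ Finset.range (p ^ (n + 1)), (-1) ^ a * F a
      - ∑ a ∈ Finset.range (p ^ n), (-1) ^ a * F a‖ ≤ (p : ℝ)⁻¹ ^ n := by
    intro n hn
    -- As p is odd, the p blocks carry signs (-1)^j adding up to 1, so consecutive sums differ only
    -- by Lipschitz differences.
    have hs : ∑ j ∈ Finset.range p, (-1 : K) ^ j = 1 := by
      rw [neg_one_geom_sum, if_neg (Nat.not_even_iff_odd.2 hodd)]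
    have h2 : ∑ a ∈ Finset.range (p ^ (n + 1)), (-1) ^ a * F a
        - ∑ a ∈ Finset.range (p ^ n), (-1) ^ a * F a = ∑ j ∈ Finset.range p,
          ∑ a ∈ Finset.range (p ^ n), (-1) ^ j * (-1) ^ a * (F (a + p ^ n * j) - F a) := by
      rw [pow_succ, sum_range_mul_eq]
      simp only [mul_sub, Finset.sum_sub_distrib]
      congr 1
      · refine Finset.sum_congr rfl fun j _ => Finset.sum_congr rfl fun a _ => ?_
        rw [pow_add, pow_mul, (hodd.pow).neg_one_pow]
        ring
      · simp only [mul_assoc]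
        rw [← Finset.sum_mul_sum, hs, one_mul]
    rw [h2]
    refine IsUltrametricDist.norm_sum_le_of_forall_le_of_nonneg (by positivity) fun j _ =>
      IsUltrametricDist.norm_sum_le_of_forall_le_of_nonneg (by positivity) fun a _ => ?_
    rw [norm_mul, norm_mul, norm_pow, norm_pow, norm_neg, norm_one, one_pow, one_pow, one_mul,
      one_mul]
    exact hF.2 n hn a j
  have h3 : CauchySeq fun k => ∑ a ∈ Finset.range (p ^ (k + M)), (-1) ^ a * F a := by
    refine cauchySeq_of_le_geometric (p : ℝ)⁻¹ 1 (inv_prime_lt_one p) fun k => ?_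
    rw [dist_comm, dist_eq_norm, one_mul, add_right_comm]
    exact (h1 _ (Nat.le_add_left _ _)).trans
      (pow_le_pow_of_le_one hp0.le (inv_prime_lt_one p).le (by omega))
  obtain ⟨l, hl⟩ := cauchySeq_tendsto_of_complete h3
  exact ⟨l, (tendsto_add_atTop_iff_nat M).1 hl⟩

end Lipschitz

/-! ### Characters on numbers prime to p -/

section Characters

variable {p : ℕ} [hp : Fact p.Prime] {K : Type*} [NormedField K]

/-- Multiplicative functions modulo `p ^ M`, supported on the numbers prime to `p`, whose
values there are roots of unity of a bounded order. -/
structure IsPChar (p M : ℕ) (c : ℕ → K) : Prop where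
  zero : ∀ a, p ∣ a → c a = 0
  periodic : ∀ a b, c (a + p ^ M * b) = c a
  mul : ∀ a b, c (a * b) = c a * c b
  root : ∃ e, e ≠ 0 ∧ ∀ a, ¬ p ∣ a → c a ^ e = 1

variable {M : ℕ} {c : ℕ → K}

lemma IsPChar.norm_eq_one (hc : IsPChar p M c) {a : ℕ} (ha : ¬ p ∣ a) : ‖c a‖ = 1 := by
  obtain ⟨e, he, h⟩ := hc.root
  exact norm_eq_one_of_pow_eq_one he (h a ha)

lemma IsPChar.norm_le_one (hc : IsPChar p M c) (a : ℕ) : ‖c a‖ ≤ 1 := by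
  by_cases ha : p ∣ a
  · rw [hc.zero a ha, norm_zero]; exact zero_le_one
  · exact (hc.norm_eq_one ha).le

lemma IsPChar.isLip [IsUltrametricDist K] (hc : IsPChar p M c) : IsLip p M c :=
  isLip_of_periodic hc.norm_le_one hc.periodic

lemma not_dvd_two (hp2 : 2 < p) : ¬ p ∣ 2 := fun h => absurd (Nat.le_of_dvd two_pos h) (by omega)

/-- Period 1 would force c(1) = c(0) = 0, but c(1) is a root of unity. -/
lemma IsPChar.pos (hc : IsPChar p M c) : 1 ≤ M := by
  by_contra h
  have h0 : M = 0 := by omega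
  have h1 := hc.periodic 0 1
  have hz := hc.zero 0 (dvd_zero p)
  have h2 := hc.norm_eq_one (a := 1) fun h => hp.1.one_lt.ne' (Nat.dvd_one.1 h)
  simp [h0, hz] at h1
  rw [h1, norm_zero] at h2
  exact zero_ne_one h2

variable [NormedAlgebra ℚ_[p] K] [IsUltrametricDist K]

/-- c vanishes on multiples of p, and inversion preserves distances between units. -/
lemma IsPChar.isLip_mul_inv (hc : IsPChar p M c) : IsLip p M fun a => c a * (a : K)⁻¹ := by
  have hp0 := inv_prime_pos p
  refine ⟨fun a => ?_, fun n hn a b => ?_⟩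
  · by_cases ha : p ∣ a
    · simp [hc.zero a ha]
    · rw [norm_mul, hc.norm_eq_one ha, norm_inv, norm_natCast_eq_one p K ha]; simp
  · beta_reduce
    rw [(show c (a + p ^ n * b) = c a by
      obtain ⟨k, rfl⟩ := Nat.exists_eq_add_of_le hn
      rw [pow_add, mul_assoc, hc.periodic])]
    by_cases ha : p ∣ a
    · rw [hc.zero a ha, zero_mul, zero_mul, sub_self, norm_zero]; positivity
    · have hM := hc.pos
      have hb : ¬ p ∣ a + p ^ n * b := by
        rwa [Nat.dvd_add_left ((dvd_pow_self p (by omega)).mul_right b)]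
      have h1 := norm_natCast_eq_one p K ha
      have h2 := norm_natCast_eq_one p K hb
      have h1' : (a : K) ≠ 0 := norm_ne_zero_iff.1 (by rw [h1]; exact one_ne_zero)
      have h2' : ((a + p ^ n * b : ℕ) : K) ≠ 0 :=
        norm_ne_zero_iff.1 (by rw [h2]; exact one_ne_zero)
      rw [← mul_sub, inv_sub_inv h2' h1', norm_mul, hc.norm_eq_one ha, norm_div, norm_mul, h1, h2,
        norm_sub_rev]
      simpa using (isLip_natCast (p := p) (K := K)).2 n (Nat.zero_le n) a b

end Characters

/-! ### The Teichmüller character and the power series of the numerator -/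

section Teichmuller

variable (p : ℕ) [hp : Fact p.Prime] (K : Type*) [NormedField K] [NormedAlgebra ℚ_[p] K]

/-- The Teichmüller character on natural numbers. -/
def teich (a : ℕ) : K := emb K (teichmullerInt p (a : ZMod p))

lemma teich_of_dvd {a : ℕ} (h : p ∣ a) : teich p K a = 0 := by
  rw [teich, (ZMod.natCast_eq_zero_iff a p).2 h, MulChar.map_zero, map_zero]

lemma teich_pow_eq_one {a : ℕ} (h : ¬ p ∣ a) : teich p K a ^ (p - 1) = 1 := by
  have ha : (a : ZMod p) ≠ 0 := by rwa [Ne, ZMod.natCast_eq_zero_iff]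
  rw [teich, ← map_pow, ← map_pow, ZMod.pow_card_sub_one_eq_one ha, map_one, map_one]

lemma emb_angle (a : ℕ) : emb K (angle (a : ℤ_[p])) = a * (teich p K a)⁻¹ := by
  have h : teichmullerInt p (a : ZMod p)⁻¹ * teichmullerInt p (a : ZMod p)
      = if p ∣ a then 0 else 1 := by
    rw [← map_mul]
    split_ifs with h
    · rw [(ZMod.natCast_eq_zero_iff a p).2 h, mul_zero, MulChar.map_zero]
    · have ha : (a : ZMod p) ≠ 0 := by rwa [Ne, ZMod.natCast_eq_zero_iff]
      rw [inv_mul_cancel₀ ha, map_one]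
  rw [angle, map_natCast, map_mul, map_natCast]
  congr 1
  by_cases hd : p ∣ a
  · rw [teich_of_dvd p K hd, inv_zero, (ZMod.natCast_eq_zero_iff a p).2 hd, inv_zero,
      MulChar.map_zero, map_zero]
  · rw [if_neg hd] at h
    refine eq_inv_of_mul_eq_one_left ?_
    rw [teich, ← map_mul, h, map_one]

lemma norm_teich_inv_le (a : ℕ) : ‖(teich p K a)⁻¹‖ ≤ 1 := by
  by_cases h : p ∣ a
  · rw [teich_of_dvd p K h, inv_zero, norm_zero]; exact zero_le_one
  · have h1 := teich_pow_eq_one p K h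
    have := norm_eq_one_of_pow_eq_one (by have := hp.1.two_le; omega) h1
    rw [norm_inv, this, inv_one]

lemma teich_periodic {M : ℕ} (hM : 1 ≤ M) (a b : ℕ) :
    teich p K (a + p ^ M * b) = teich p K a := by
  unfold teich
  obtain ⟨k, rfl⟩ := Nat.exists_eq_add_of_le hM
  push_cast
  rw [add_comm 1 k, pow_succ]
  simp

variable {p K}

/-- Used for the twists χω^{-k}; the values of ω at numbers prime to p are (p - 1)-th roots of
unity. -/
lemma IsPChar.mul_teich_inv_pow {M : ℕ} {c : ℕ → K} (hc : IsPChar p M c) (k : ℕ) :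
    IsPChar p M fun a => c a * (teich p K a)⁻¹ ^ k := by
  obtain ⟨e, he, h⟩ := hc.root
  refine ⟨fun a ha => by rw [hc.zero a ha, zero_mul], fun a b => by
    rw [hc.periodic, teich_periodic p K hc.pos], fun a b => ?_, (p - 1) * e,
    mul_ne_zero (by have := hp.1.two_le; omega) he, fun a ha => ?_⟩
  · rw [hc.mul, teich, Nat.cast_mul, map_mul, map_mul, mul_inv, mul_pow]
    rw [← teich, ← teich]
    ring
  · rw [mul_pow, pow_mul', h a ha, one_pow, one_mul, pow_mul, pow_right_comm _ k,
      inv_pow, teich_pow_eq_one p K ha, inv_one, one_pow, one_pow]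

variable [IsUltrametricDist K]

lemma isLip_emb_angle {M : ℕ} (hM : 1 ≤ M) :
    IsLip p M fun a => emb K (angle (a : ℤ_[p])) := by
  simp only [emb_angle]
  exact (isLip_natCast.mono (Nat.zero_le M)).mul
    (isLip_of_periodic (norm_teich_inv_le p K) fun a b => by rw [teich_periodic p K hM])

variable [CompleteSpace K]

variable (p K) in
lemma norm_two (hp2 : 2 < p) : ‖(2 : K)‖ = 1 := by
  exact_mod_cast norm_natCast_eq_one p K (not_dvd_two hp2)

/-- The alternating sums of `c(a) a⁻¹ ⟨a⟩ ^ t` converge to a power series in `t`. -/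
lemma IsPChar.exists_tendsto_ev (hp2 : 2 < p) {M : ℕ} {c : ℕ → K} (hc : IsPChar p M c) :
    ∃ f : PowerSeries K, IsBdd p 1 f ∧ ∀ t : ℤ_[p],
      Tendsto (fun n => ∑ a ∈ Finset.range (p ^ n), (-1) ^ a / 2 *
        (c a * (a : K)⁻¹ * emb K (onePow (angle (a : ℤ_[p])) t))) atTop (𝓝 (ev f t)) := by
  have hp0 := inv_prime_pos p
  have hn2 : ‖(2 : K)‖ = 1 := norm_two p K hp2
  -- The halved alternating sums of G j converge to the j-th Mahler coefficient of the numerator.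
  set G : ℕ → ℕ → K := fun j a => c a * (a : K)⁻¹ * (emb K (angle (a : ℤ_[p])) - 1) ^ j with hG
  have hGl : ∀ j, IsLip p M (G j) := fun j =>
    hc.isLip_mul_inv.mul ((isLip_emb_angle hc.pos).sub_one.pow j)
  have hGn : ∀ j a, ‖G j a‖ ≤ (p : ℝ)⁻¹ ^ j := fun j a => by
    by_cases ha : p ∣ a
    · rw [hG]
      simp only [hc.zero a ha, zero_mul, norm_zero]
      positivity
    · rw [hG]
      beta_reduce
      rw [norm_mul, norm_pow, ← map_one (emb (p := p) K), ← map_sub, norm_emb]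
      exact (mul_le_of_le_one_left (by positivity) (hc.isLip_mul_inv.1 a)).trans
        (pow_le_pow_left₀ (norm_nonneg _) (norm_sub_one_le (norm_angle_sub_one_lt ha)) j)
  have hex : ∀ j, ∃ d : K, Tendsto (fun n => ∑ a ∈ Finset.range (p ^ n), (-1) ^ a / 2 * G j a)
      atTop (𝓝 d) := fun j => by
    obtain ⟨l, hl⟩ := (hGl j).exists_tendsto_alternating hp2
    refine ⟨l / 2, (hl.div_const 2).congr fun n => ?_⟩
    rw [Finset.sum_div]
    exact Finset.sum_congr rfl fun a _ => by ring
  choose d hd using hex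
  have hsn : ∀ j n, ‖∑ a ∈ Finset.range (p ^ n), (-1) ^ a / 2 * G j a‖ ≤ (p : ℝ)⁻¹ ^ j :=
    fun j n => by
      refine IsUltrametricDist.norm_sum_le_of_forall_le_of_nonneg (by positivity) fun a _ => ?_
      rw [norm_mul, norm_div, norm_pow, norm_neg, norm_one, one_pow, hn2, div_one, one_mul]
      exact hGn j a
  have hdn : ∀ j, ‖d j‖ ≤ 1 * (p : ℝ)⁻¹ ^ j := fun j => by
    rw [one_mul]
    exact le_of_tendsto (hd j).norm (Eventually.of_forall fun n => hsn j n)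
  obtain ⟨f, hf, -, hft⟩ := exists_hasSum_mahler hp2 hdn
  refine ⟨f, hf, fun t => ?_⟩
  have hterm : ∀ a, HasSum (fun j => emb K (mahler j t) * G j a)
      (c a * (a : K)⁻¹ * emb K (onePow (angle (a : ℤ_[p])) t)) := fun a => by
    by_cases ha : p ∣ a
    · simp only [hG, hc.zero a ha, zero_mul, mul_zero]
      exact hasSum_zero
    · have h1 := (hasSum_onePow K (norm_angle_sub_one_lt ha) t).mul_left (c a * (a : K)⁻¹)
      refine Eq.mp (congrArg (HasSum · _) (funext fun j => ?_)) h1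
      rw [map_sub, map_one]
      ring
  have hsum : ∀ n, HasSum (fun j => emb K (mahler j t) *
      ∑ a ∈ Finset.range (p ^ n), (-1) ^ a / 2 * G j a)
      (∑ a ∈ Finset.range (p ^ n), (-1) ^ a / 2 *
        (c a * (a : K)⁻¹ * emb K (onePow (angle (a : ℤ_[p])) t))) := fun n => by
    have h1 := hasSum_sum fun a (_ : a ∈ Finset.range (p ^ n)) =>
      (hterm a).mul_left ((-1) ^ a / 2)
    refine Eq.mp (congrArg (HasSum · _) (funext fun j => ?_)) h1
    rw [Finset.mul_sum]
    exact Finset.sum_congr rfl fun a _ => by ring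
  simp_rw [← (hft t).tsum_eq, ← fun n => (hsum n).tsum_eq]
  -- The bound p^{-j}, uniform in n, allows taking the limit under the Mahler sum.
  refine tendsto_tsum_of_dominated_convergence
    (summable_geometric_of_lt_one hp0.le (inv_prime_lt_one p))
    (fun j => (hd j).const_mul _) (Eventually.of_forall fun n j => ?_)
  rw [norm_mul, norm_emb]
  exact (mul_le_of_le_one_left (norm_nonneg _) (PadicInt.norm_le_one _)).trans (hsn j n)

end Teichmuller

/-! ### The doubling argument -/

section Doubling

variable {p : ℕ} [hp : Fact p.Prime] {K : Type*} [NormedField K] [NormedAlgebra ℚ_[p] K]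
  [IsUltrametricDist K]

/-- Since i + 2 < 3^{i+1} ≤ p^{i+1}, the valuation of i + 2 is at most i. -/
lemma norm_pow_le_norm_natCast (hp2 : 2 < p) (i : ℕ) :
    (p : ℝ)⁻¹ ^ i ≤ ‖((i + 2 : ℕ) : K)‖ := by
  have hp0 := inv_prime_pos p
  rw [← map_natCast (algebraMap ℚ_[p] K), norm_algebraMap', Padic.norm_eq_zpow_neg_valuation
      (by exact_mod_cast (i + 1).succ_ne_zero), Padic.valuation_natCast, zpow_neg, zpow_natCast,
      ← inv_pow]
  refine pow_le_pow_of_le_one hp0.le (inv_prime_lt_one p).le ?_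
  by_contra h
  have h1 : p ^ padicValNat p (i + 2) ≤ i + 2 := Nat.le_of_dvd (by omega) pow_padicValNat_dvd
  have h2 : p ^ (i + 1) ≤ p ^ padicValNat p (i + 2) := Nat.pow_le_pow_right hp.1.pos (by omega)
  have h3 : 3 ^ (i + 1) ≤ p ^ (i + 1) := Nat.pow_le_pow_left hp2 _
  have h4 : i + 2 < 3 ^ (i + 1) := by
    clear h h1 h2 h3
    induction i with
    | zero => norm_num
    | succ i ih => rw [pow_succ]; omega
  omega

/-- First order expansion of `(a + N) ^ k`, uniformly in `k`. -/
lemma norm_add_pow_sub_le (hp2 : 2 < p) (a n k : ℕ) (hn : 1 ≤ n) :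
    ‖((a + p ^ n : ℕ) : K) ^ (k + 1) - (a : K) ^ (k + 1)
      - ((k + 1 : ℕ) : K) * (p : K) ^ n * (a : K) ^ k‖
      ≤ ‖((k + 1 : ℕ) : K)‖ * ((p : ℝ)⁻¹ ^ n * (p : ℝ)⁻¹ ^ n) := by
  have hp0 := inv_prime_pos p
  have hK : CharZero K := (RingHom.charZero_iff (algebraMap ℚ_[p] K).injective).1 inferInstance
  have h1 : ((a + p ^ n : ℕ) : K) ^ (k + 1) - (a : K) ^ (k + 1)
      - ((k + 1 : ℕ) : K) * (p : K) ^ n * (a : K) ^ k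
      = ∑ i ∈ Finset.range k, ((p : K) ^ n) ^ (i + 2) * (a : K) ^ (k + 1 - (i + 2)) *
        ((k + 1).choose (i + 2) : K) := by
    push_cast
    rw [add_comm (a : K), add_pow, Finset.sum_range_succ', Finset.sum_range_succ']
    simp
    ring
  rw [h1]
  refine IsUltrametricDist.norm_sum_le_of_forall_le_of_nonneg (by positivity) fun i _ => ?_
  -- Extracting k + 1 keeps the error proportional to |k + 1|, which makes the estimate survive
  -- exponents tending to 0 p-adically.
  have h2 : ((k + 1).choose (i + 2) : K) = ((k + 1 : ℕ) : K) * (k.choose (i + 1) : K)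
      / ((i + 2 : ℕ) : K) := by
    rw [eq_div_iff (by exact_mod_cast (i + 1).succ_ne_zero)]
    exact_mod_cast (Nat.add_one_mul_choose_eq k (i + 1)).symm
  have h3 : 0 < ‖((i + 2 : ℕ) : K)‖ :=
    norm_pos_iff.2 (by exact_mod_cast (i + 1).succ_ne_zero)
  rw [h2, norm_mul, norm_mul, norm_div, norm_mul, norm_pow, norm_pow, norm_pow, norm_prime p K,
    mul_div_assoc', div_le_iff₀ h3]
  calc ((p : ℝ)⁻¹ ^ n) ^ (i + 2) * ‖(a : K)‖ ^ (k + 1 - (i + 2)) *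
        (‖((k + 1 : ℕ) : K)‖ * ‖(k.choose (i + 1) : K)‖)
      ≤ ((p : ℝ)⁻¹ ^ n) ^ (i + 2) * 1 * (‖((k + 1 : ℕ) : K)‖ * 1) := by
        gcongr
        · exact pow_le_one₀ (norm_nonneg _) (norm_natCast_le_one p K _)
        · exact norm_natCast_le_one p K _
    _ = ‖((k + 1 : ℕ) : K)‖ * ((p : ℝ)⁻¹ ^ n * (p : ℝ)⁻¹ ^ n) * ((p : ℝ)⁻¹ ^ n) ^ i := by ring
    _ ≤ _ := by
        gcongr
        refine le_trans ?_ (norm_pow_le_norm_natCast (p := p) (K := K) hp2 i)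
        gcongr
        exact pow_le_of_le_one hp0.le (inv_prime_lt_one p).le (by omega)

lemma two_mul_div_two_add_one (hp2 : 2 < p) (n : ℕ) : 2 * (p ^ n / 2) + 1 = p ^ n :=
  Nat.two_mul_div_two_add_one_of_odd (hp.1.odd_of_ne_two hp2.ne').pow

/-- Comparing the sum of `c(a) a ^ k` with the one of `c(2 a) (2 a) ^ k`. -/
lemma IsPChar.norm_doubling_le (hp2 : 2 < p) {M : ℕ} {c : ℕ → K} (hc : IsPChar p M c) {n : ℕ}
    (hn : M ≤ n) (k : ℕ) :
    ‖(c 2 * 2 ^ (k + 1) - 1) *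
        (((p : K) ^ n)⁻¹ * ∑ a ∈ Finset.range (p ^ n), c a * (a : K) ^ (k + 1))
      - ((k + 1 : ℕ) : K) * ∑ i ∈ Finset.range (p ^ n / 2),
        c (2 * i + 1) * ((2 * i + 1 : ℕ) : K) ^ k‖
      ≤ ‖((k + 1 : ℕ) : K)‖ * (p : ℝ)⁻¹ ^ n := by
  have hp0 := inv_prime_pos p
  have hK : CharZero K := (RingHom.charZero_iff (algebraMap ℚ_[p] K).injective).1 inferInstance
  have hN : (p : K) ^ n ≠ 0 := pow_ne_zero _ (by exact_mod_cast hp.1.ne_zero)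
  have h1 := sum_range_double (fun a => c a * (a : K) ^ (k + 1)) (p ^ n / 2)
  simp only [two_mul_div_two_add_one hp2] at h1
  have hcp : ∀ a, c (a + p ^ n) = c a := fun a => by
    obtain ⟨e, rfl⟩ := Nat.exists_eq_add_of_le hn
    rw [pow_add, hc.periodic]
  have h2 : ∑ a ∈ Finset.range (p ^ n), c (2 * a) * ((2 * a : ℕ) : K) ^ (k + 1)
      = c 2 * 2 ^ (k + 1) * ∑ a ∈ Finset.range (p ^ n), c a * (a : K) ^ (k + 1) := by
    rw [Finset.mul_sum]
    refine Finset.sum_congr rfl fun a _ => ?_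
    rw [hc.mul]; push_cast; ring
  rw [h2, ← sub_eq_iff_eq_add'] at h1
  have h3 : (c 2 * 2 ^ (k + 1) - 1) *
        (((p : K) ^ n)⁻¹ * ∑ a ∈ Finset.range (p ^ n), c a * (a : K) ^ (k + 1))
      - ((k + 1 : ℕ) : K) * ∑ i ∈ Finset.range (p ^ n / 2),
        c (2 * i + 1) * ((2 * i + 1 : ℕ) : K) ^ k
      = ((p : K) ^ n)⁻¹ * ∑ i ∈ Finset.range (p ^ n / 2), c (2 * i + 1) *
        (((2 * i + 1 + p ^ n : ℕ) : K) ^ (k + 1) - ((2 * i + 1 : ℕ) : K) ^ (k + 1)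
          - ((k + 1 : ℕ) : K) * (p : K) ^ n * ((2 * i + 1 : ℕ) : K) ^ k) := by
    have h4 : (c 2 * 2 ^ (k + 1) - 1) *
        (((p : K) ^ n)⁻¹ * ∑ a ∈ Finset.range (p ^ n), c a * (a : K) ^ (k + 1))
        = ((p : K) ^ n)⁻¹ * (c 2 * 2 ^ (k + 1) *
          ∑ a ∈ Finset.range (p ^ n), c a * (a : K) ^ (k + 1)
          - ∑ a ∈ Finset.range (p ^ n), c a * (a : K) ^ (k + 1)) := by ring
    rw [h4, h1, Finset.mul_sum, Finset.mul_sum, Finset.mul_sum, ← Finset.sum_sub_distrib]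
    refine Finset.sum_congr rfl fun i _ => ?_
    rw [hcp]
    field_simp
  rw [h3, norm_mul, norm_inv, norm_pow, norm_prime p K, inv_mul_le_iff₀ (by positivity)]
  refine IsUltrametricDist.norm_sum_le_of_forall_le_of_nonneg (by positivity) fun i _ => ?_
  rw [norm_mul]
  refine (mul_le_of_le_one_left (norm_nonneg _) (hc.norm_le_one _)).trans
    ((norm_add_pow_sub_le hp2 _ n k (hc.pos.trans hn)).trans (le_of_eq (by ring)))

/-- The odd part of an alternating sum. -/
lemma IsLip.tendsto_sum_odd (hp2 : 2 < p) {M : ℕ} {F : ℕ → K} (hF : IsLip p M F) {l : K}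
    (hl : Tendsto (fun n => ∑ a ∈ Finset.range (p ^ n), (-1) ^ a / 2 * F a) atTop (𝓝 l)) :
    Tendsto (fun n => ∑ i ∈ Finset.range (p ^ n / 2), F (2 * i + 1)) atTop (𝓝 (-l)) := by
  have hK : CharZero K := (RingHom.charZero_iff (algebraMap ℚ_[p] K).injective).1 inferInstance
  have h1 := (hF.tendsto_sum.div_const 2).sub hl
  rw [zero_div, zero_sub] at h1
  refine h1.congr fun n => ?_
  have h2 := sum_range_alternating F (p ^ n / 2)
  rw [two_mul_div_two_add_one hp2] at h2
  have h3 : ∑ a ∈ Finset.range (p ^ n), (-1) ^ a / 2 * F a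
      = (∑ a ∈ Finset.range (p ^ n), (-1) ^ a * F a) / 2 := by
    rw [Finset.sum_div]
    exact Finset.sum_congr rfl fun a _ => by ring
  rw [h3, h2]
  ring

/-- Alternating sums of `c(a) a ^ (k - 1)` in terms of Bernoulli type sums. -/
lemma IsPChar.eq_of_tendsto (hp2 : 2 < p) {M : ℕ} {c : ℕ → K} (hc : IsPChar p M c) {k : ℕ}
    (hk : 1 ≤ k) {B l : K}
    (hB : Tendsto (fun n => ((p : K) ^ n)⁻¹ * ∑ a ∈ Finset.range (p ^ n), c a * (a : K) ^ k)
      atTop (𝓝 B))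
    (hl : Tendsto (fun n => ∑ a ∈ Finset.range (p ^ n), (-1) ^ a / 2 * (c a * (a : K) ^ (k - 1)))
      atTop (𝓝 l)) :
    (1 - c 2 * 2 ^ k) * B = k * l := by
  have hp0 := inv_prime_pos p
  obtain ⟨k, rfl⟩ : ∃ k', k = k' + 1 := ⟨k - 1, by omega⟩
  rw [Nat.add_sub_cancel] at hl
  have hF : IsLip p M fun a => c a * (a : K) ^ k :=
    hc.isLip.mul ((isLip_natCast.mono (Nat.zero_le M)).pow k)
  have h1 := hF.tendsto_sum_odd hp2 hl
  have h2 := (hB.const_mul (c 2 * 2 ^ (k + 1) - 1)).sub (h1.const_mul ((k + 1 : ℕ) : K))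
  have h3 : Tendsto (fun n => (c 2 * 2 ^ (k + 1) - 1) *
        (((p : K) ^ n)⁻¹ * ∑ a ∈ Finset.range (p ^ n), c a * (a : K) ^ (k + 1))
      - ((k + 1 : ℕ) : K) * ∑ i ∈ Finset.range (p ^ n / 2),
        c (2 * i + 1) * ((2 * i + 1 : ℕ) : K) ^ k) atTop (𝓝 0) := by
    refine squeeze_zero_norm' (eventually_atTop.2 ⟨M, fun n hn => hc.norm_doubling_le hp2 hn k⟩) ?_
    simpa using (tendsto_pow_atTop_nhds_zero_of_lt_one hp0.le
      (inv_prime_lt_one p)).const_mul ‖((k + 1 : ℕ) : K)‖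
  have h4 := tendsto_nhds_unique h2 h3
  linear_combination -h4

end Doubling

/-! ### The value at t = 0, that is, the residue -/

section ValueAtZero

variable {p : ℕ} [hp : Fact p.Prime] {K : Type*} [NormedField K] [NormedAlgebra ℚ_[p] K]
  [IsUltrametricDist K] [CompleteSpace K]

lemma continuous_onePow (u : ℤ_[p]) : Continuous (onePow u) :=
  ContinuousMap.continuous (PadicInt.mahlerSeries (fun n : ℕ => (u - 1) ^ n) : C(ℤ_[p], ℤ_[p]))

lemma onePow_zero {u : ℤ_[p]} (hu : ‖u - 1‖ < 1) : onePow u 0 = 1 := by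
  simpa using onePow_natCast hu 0

lemma emb_onePow_angle {a : ℕ} (ha : ¬ p ∣ a) (k : ℕ) :
    emb K (onePow (angle (a : ℤ_[p])) (k : ℤ_[p])) = (a : K) ^ k * (teich p K a)⁻¹ ^ k := by
  rw [onePow_natCast (norm_angle_sub_one_lt ha), map_pow, emb_angle, mul_pow]

lemma emb_onePow_angle_of_dvd {a : ℕ} (ha : ¬ p ∣ a) {k : ℕ} (hk : p - 1 ∣ k) :
    emb K (onePow (angle (a : ℤ_[p])) (k : ℤ_[p])) = (a : K) ^ k := by
  obtain ⟨e, rfl⟩ := hk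
  rw [emb_onePow_angle ha, pow_mul _ (p - 1), pow_mul _ (p - 1), inv_pow,
    teich_pow_eq_one p K ha, inv_one, one_pow, mul_one]

/-- The value at `t = 0` of the limit of the alternating sums if `c(2) = 1`. -/
lemma IsPChar.ev_zero_mul (hp2 : 2 < p) {M : ℕ} {c : ℕ → K} (hc : IsPChar p M c) (hc2 : c 2 = 1)
    {f h : PowerSeries K} {D : ℝ} (hh : IsBdd p D h)
    (hf : Tendsto (fun n => ∑ a ∈ Finset.range (p ^ n), (-1) ^ a / 2 *
        (c a * (a : K)⁻¹ * emb K (onePow (angle (a : ℤ_[p])) 0))) atTop (𝓝 (ev f (0 : ℤ_[p]))))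
    (hu : ∀ t : ℤ_[p], ev h t * (1 - emb K (onePow (angle ((2 : ℕ) : ℤ_[p])) t)) = emb K t)
    {B : K} (hB : ∀ n, M ≤ n → ((p : K) ^ n)⁻¹ * ∑ a ∈ Finset.range (p ^ n), c a = B) :
    ev f (0 : ℤ_[p]) * ev h (0 : ℤ_[p]) = B := by
  have hp0 := inv_prime_pos p
  have hK : CharZero K := (RingHom.charZero_iff (algebraMap ℚ_[p] K).injective).1 inferInstance
  have hp1 : p - 1 ≠ 0 := by omega
  -- These exponents tend to 0 in ℤ_p and are divisible by p - 1, so ⟨a⟩^κ = a^κ for a prime to p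
  -- and no Teichmüller twist intervenes.
  set κ : ℕ → ℕ := fun r => (p - 1) * p ^ r with hκ
  have hκ0 : ∀ r, κ r ≠ 0 := fun r => mul_ne_zero hp1 (pow_ne_zero _ hp.1.ne_zero)
  have hκt : Tendsto (fun r => (κ r : ℤ_[p])) atTop (𝓝 0) := by
    have h1 : Tendsto (fun r => (p : ℤ_[p]) ^ r) atTop (𝓝 0) :=
      tendsto_pow_atTop_nhds_zero_iff_norm_lt_one.2 (by rw [PadicInt.norm_p]; exact inv_prime_lt_one p)
    simpa [hκ] using h1.const_mul ((p - 1 : ℕ) : ℤ_[p])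
  have hpow : ∀ a, ¬ p ∣ a → Tendsto (fun r => (a : K) ^ κ r) atTop (𝓝 1) := fun a ha => by
    have h1 := ((continuous_emb K).comp (continuous_onePow (angle (a : ℤ_[p])))).tendsto 0
    have h2 := h1.comp hκt
    simp only [Function.comp_def, onePow_zero (norm_angle_sub_one_lt ha), map_one] at h2
    exact h2.congr fun r => emb_onePow_angle_of_dvd ha (dvd_mul_right _ _)
  have hc1 : ∀ a, Tendsto (fun r => c a * (a : K) ^ κ r) atTop (𝓝 (c a)) := fun a => by
    by_cases ha : p ∣ a
    · simp [hc.zero a ha]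
    · simpa using (hpow a ha).const_mul (c a)
  have hc2' : ∀ a, Tendsto (fun r => c a * (a : K) ^ (κ r - 1)) atTop (𝓝 (c a * (a : K)⁻¹)) :=
    fun a => by
      by_cases ha : p ∣ a
      · simp [hc.zero a ha]
      · have ha0 : (a : K) ≠ 0 := by
          rintro h0
          exact ha (by rw [Nat.cast_eq_zero.1 h0]; exact dvd_zero p)
        refine ((hc1 a).mul_const (a : K)⁻¹).congr fun r => ?_
        rw [← pow_sub_one_mul (hκ0 r) (a : K), mul_assoc, mul_inv_cancel_right₀ ha0]
  -- For fixed n this is the limit r → ∞ of the doubling estimate divided by κ r; n → ∞ comes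
  -- afterwards.
  have key : ∀ n, M ≤ n → ‖B + ev h (0 : ℤ_[p]) * ∑ i ∈ Finset.range (p ^ n / 2),
      c (2 * i + 1) * ((2 * i + 1 : ℕ) : K)⁻¹‖ ≤ (p : ℝ)⁻¹ ^ n * ‖ev h (0 : ℤ_[p])‖ := by
    intro n hn
    have hev : Tendsto (fun r => ev h (κ r : ℤ_[p])) atTop (𝓝 (ev h (0 : ℤ_[p]))) :=
      (hh.continuous.tendsto 0).comp hκt
    have h1 : Tendsto (fun r => ((p : K) ^ n)⁻¹ *
        ∑ a ∈ Finset.range (p ^ n), c a * (a : K) ^ κ r) atTop (𝓝 B) := by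
      rw [← hB n hn]
      exact (tendsto_finsetSum _ fun a _ => hc1 a).const_mul _
    have h2 := h1.add (hev.mul (tendsto_finsetSum (Finset.range (p ^ n / 2))
      fun i _ => hc2' (2 * i + 1)))
    refine le_of_tendsto_of_tendsto h2.norm (hev.norm.const_mul _)
      (Eventually.of_forall fun r => ?_)
    obtain ⟨k, hk⟩ : ∃ k, κ r = k + 1 := ⟨κ r - 1, by have := hκ0 r; omega⟩
    have h3 := hc.norm_doubling_le hp2 hn k
    have h4 := hu (κ r : ℤ_[p])
    rw [emb_onePow_angle_of_dvd (not_dvd_two hp2) (dvd_mul_right _ _), map_natCast] at h4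
    have hk0 : 0 < ‖((κ r : ℕ) : K)‖ := norm_pos_iff.2 (by exact_mod_cast hκ0 r)
    simp only [← hk] at h3
    rw [hc2, one_mul] at h3
    beta_reduce
    rw [hk, Nat.add_sub_cancel, ← hk]
    refine le_of_mul_le_mul_left ?_ hk0
    rw [← norm_mul]
    set S := ((p : K) ^ n)⁻¹ * ∑ a ∈ Finset.range (p ^ n), c a * (a : K) ^ κ r
    set O := ∑ i ∈ Finset.range (p ^ n / 2), c (2 * i + 1) * ((2 * i + 1 : ℕ) : K) ^ k
    -- Because κ r = h(κ r)(1 - 2^{κ r}), the vanishing factor 2^{κ r} - 1 is traded for κ r, which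
    -- cancels.
    have h5 : (κ r : K) * (S + ev h (κ r : ℤ_[p]) * O)
        = -(ev h (κ r : ℤ_[p]) * ((2 ^ κ r - 1) * S - (κ r : K) * O)) := by
      have h6 : (κ r : K) = ev h (κ r : ℤ_[p]) * (1 - 2 ^ κ r) := by
        rw [← h4]; norm_cast
      linear_combination S * h6
    rw [h5, norm_neg, norm_mul]
    calc _ ≤ ‖ev h (κ r : ℤ_[p])‖ * (‖(κ r : K)‖ * (p : ℝ)⁻¹ ^ n) := by gcongr
      _ = _ := by ring
  have h1 : Tendsto (fun n => ∑ a ∈ Finset.range (p ^ n), (-1) ^ a / 2 * (c a * (a : K)⁻¹))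
      atTop (𝓝 (ev f (0 : ℤ_[p]))) := by
    refine hf.congr fun n => Finset.sum_congr rfl fun a _ => ?_
    by_cases ha : p ∣ a
    · simp [hc.zero a ha]
    · rw [onePow_zero (norm_angle_sub_one_lt ha), map_one, mul_one]
  have h2 := hc.isLip_mul_inv.tendsto_sum_odd hp2 h1
  have h3 := (h2.const_mul (ev h (0 : ℤ_[p]))).const_add B
  have h4 : Tendsto (fun n => B + ev h (0 : ℤ_[p]) * ∑ i ∈ Finset.range (p ^ n / 2),
      c (2 * i + 1) * ((2 * i + 1 : ℕ) : K)⁻¹) atTop (𝓝 0) := by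
    refine squeeze_zero_norm' (eventually_atTop.2 ⟨M, key⟩) ?_
    simpa using (tendsto_pow_atTop_nhds_zero_of_lt_one hp0.le
      (inv_prime_lt_one p)).mul_const ‖ev h (0 : ℤ_[p])‖
  have h5 := tendsto_nhds_unique h3 h4
  linear_combination -h5

end ValueAtZero

/-! ### Generalized Bernoulli numbers as p-adic limits of power sums -/

section Bernoulli

lemma sum_Icc_one_eq {A : Type*} [AddCommMonoid A] (g : ℕ → A) (N : ℕ) :
    ∑ a ∈ Finset.Icc 1 N, g a = ∑ a ∈ Finset.range N, g (a + 1) := by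
  induction N with
  | zero => simp
  | succ N ih => rw [Finset.sum_Icc_succ_top (by omega), ih, Finset.sum_range_succ]

/-- Sums of powers in arithmetic progressions via Bernoulli polynomials. -/
lemma sum_range_add_mul_pow (x : ℚ) (k L : ℕ) :
    ((k : ℚ) + 1) * ∑ i ∈ Finset.range L, (x + i) ^ k
      = (Polynomial.bernoulli (k + 1)).eval (x + L) - (Polynomial.bernoulli (k + 1)).eval x := by
  induction L with
  | zero => simp
  | succ L ih =>
    have h := Polynomial.bernoulli_eval_one_add (k + 1) (x + L)
    rw [Nat.add_sub_cancel] at h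
    rw [Finset.sum_range_succ, mul_add, ih, Nat.cast_succ,
      show x + ((L : ℚ) + 1) = 1 + (x + L) by ring, h]
    push_cast
    ring

variable {p : ℕ} [hp : Fact p.Prime] {K : Type*} [NontriviallyNormedField K]
  [NormedAlgebra ℚ_[p] K]

/-- With x = a / p^j, the power sum is, up to a constant, B_{k+1}(x + p^l) - B_{k+1}(x). Division by
p^l makes it a difference quotient, and B_{k+1}' = (k + 1) B_k. -/
lemma tendsto_sum_progression {k : ℕ} (hk : 1 ≤ k) (j a : ℕ) :
    Tendsto (fun l => ((p : K) ^ (j + l))⁻¹ *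
        ∑ i ∈ Finset.range (p ^ l), ((a + p ^ j * i : ℕ) : K) ^ k) atTop
      (𝓝 (((p ^ j : ℕ) : K) ^ (k - 1) *
        (((Polynomial.bernoulli k).eval ((a : ℚ) / ((p ^ j : ℕ) : ℚ)) : ℚ) : K))) := by
  have hK : CharZero K := (RingHom.charZero_iff (algebraMap ℚ_[p] K).injective).1 inferInstance
  have hp0 : (p : K) ≠ 0 := by exact_mod_cast hp.1.ne_zero
  have hpq : (p : ℚ) ≠ 0 := by exact_mod_cast hp.1.ne_zero
  obtain ⟨k, rfl⟩ : ∃ k', k = k' + 1 := ⟨k - 1, by omega⟩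
  rw [Nat.add_sub_cancel]
  set f : ℕ := p ^ j with hf
  have hf0 : (f : ℚ) ≠ 0 := by rw [hf, Nat.cast_pow]; exact pow_ne_zero _ hpq
  have hfK : (f : K) ≠ 0 := by rw [hf, Nat.cast_pow]; exact pow_ne_zero _ hp0
  set x : ℚ := (a : ℚ) / f with hx
  set P : Polynomial K := (Polynomial.bernoulli (k + 2)).map (Rat.castHom K) with hP
  have hev : ∀ y : ℚ, P.eval (y : K) = (((Polynomial.bernoulli (k + 2)).eval y : ℚ) : K) :=
    fun y => by
      rw [hP, Polynomial.eval_map]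
      exact Polynomial.eval₂_at_apply (Rat.castHom K) y
  have hder : P.derivative.eval (x : K)
      = ((k + 2 : ℕ) : K) * (((Polynomial.bernoulli (k + 1)).eval x : ℚ) : K) := by
    rw [hP, Polynomial.derivative_map, Polynomial.derivative_bernoulli_add_one, Polynomial.eval_map]
    rw [show (x : K) = Rat.castHom K x from rfl, Polynomial.eval₂_at_apply]
    simp
    left
    ring
  have h1 := hasDerivAt_iff_tendsto_slope_zero.1 (Polynomial.hasDerivAt P (x : K))
  rw [hder] at h1
  have h2 : Tendsto (fun l : ℕ => (p : K) ^ l) atTop (𝓝[≠] 0) := by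
    refine tendsto_nhdsWithin_iff.2 ⟨?_, Eventually.of_forall fun l => pow_ne_zero _ hp0⟩
    refine tendsto_pow_atTop_nhds_zero_iff_norm_lt_one.2 ?_
    rw [norm_prime p K]
    exact inv_prime_lt_one p
  have hk2 : ((k + 2 : ℕ) : K) ≠ 0 := by exact_mod_cast (k + 1).succ_ne_zero
  have h3 := (h1.comp h2).const_mul ((f : K) ^ k * ((k + 2 : ℕ) : K)⁻¹)
  rw [show (f : K) ^ k * ((k + 2 : ℕ) : K)⁻¹ *
    (((k + 2 : ℕ) : K) * (((Polynomial.bernoulli (k + 1)).eval x : ℚ) : K))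
    = (f : K) ^ k * (((Polynomial.bernoulli (k + 1)).eval x : ℚ) : K) by field_simp] at h3
  refine h3.congr fun l => ?_
  have h4 := congrArg (Rat.cast : ℚ → K) (sum_range_add_mul_pow x (k + 1) (p ^ l))
  rw [Rat.cast_sub, ← hev, ← hev] at h4
  have h5 : ∑ i ∈ Finset.range (p ^ l), ((a + f * i : ℕ) : K) ^ (k + 1)
      = (f : K) ^ (k + 1) * ((∑ i ∈ Finset.range (p ^ l), (x + i) ^ (k + 1) : ℚ) : K) := by
    push_cast
    rw [Finset.mul_sum]
    refine Finset.sum_congr rfl fun i _ => ?_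
    rw [← mul_pow, hx]
    push_cast
    field_simp
  have h6 : (p : K) ^ (j + l) = f * (p : K) ^ l := by rw [hf, pow_add]; push_cast; ring
  simp only [Function.comp_def, smul_eq_mul]
  rw [h5, h6]
  push_cast at h4 ⊢
  rw [← h4]
  have hpl : (p : K) ^ l ≠ 0 := pow_ne_zero _ hp0
  have hk2' : (k : K) + 2 ≠ 0 := by exact_mod_cast hk2
  field_simp
  ring

/-- Generalized Bernoulli numbers as limits of power sums. -/
lemma tendsto_sum_Icc_mul_pow {k : ℕ} (hk : 1 ≤ k) (j : ℕ) {ψ : ℕ → K}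
    (hψ : ∀ a b, ψ (a + p ^ j * b) = ψ a) :
    Tendsto (fun n => ((p : K) ^ n)⁻¹ * ∑ a ∈ Finset.Icc 1 (p ^ n), ψ a * (a : K) ^ k) atTop
      (𝓝 (((p ^ j : ℕ) : K) ^ (k - 1) * ∑ a ∈ Finset.Icc 1 (p ^ j),
        ψ a * (((Polynomial.bernoulli k).eval ((a : ℚ) / ((p ^ j : ℕ) : ℚ)) : ℚ) : K))) := by
  rw [← tendsto_add_atTop_iff_nat j]
  have h1 := tendsto_finsetSum (Finset.Icc 1 (p ^ j)) fun a _ =>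
    (tendsto_sum_progression (p := p) (K := K) hk j a).const_mul (ψ a)
  rw [Finset.mul_sum]
  convert h1 using 1
  · funext l
    rw [add_comm l j, sum_Icc_one_eq, pow_add p, sum_range_mul_eq, Finset.sum_comm, sum_Icc_one_eq,
      Finset.mul_sum]
    refine Finset.sum_congr rfl fun a _ => ?_
    rw [Finset.mul_sum, Finset.mul_sum, Finset.mul_sum]
    refine Finset.sum_congr rfl fun i _ => ?_
    rw [add_right_comm, hψ]
    ring
  · congr 1
    exact Finset.sum_congr rfl fun a _ => by ring

end Bernoulli

/-! ### Removing the multiples of p: the Euler factor -/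

section PrimeToP

variable {p : ℕ} [hp : Fact p.Prime]

/-- The two ranges differ only in 0 and N, both multiples of p. -/
lemma sum_Icc_filter_not_dvd {A : Type*} [AddCommMonoid A] (g : ℕ → A) {N : ℕ} (hN : p ∣ N) :
    ∑ a ∈ Finset.Icc 1 N with ¬ p ∣ a, g a
      = ∑ a ∈ Finset.range N, if p ∣ a then 0 else g a := by
  rw [Finset.sum_filter, sum_Icc_one_eq]
  simp only [ite_not]
  have h1 := Finset.sum_range_succ' (fun a => if p ∣ a then 0 else g a) N
  rw [Finset.sum_range_succ, if_pos hN, if_pos (dvd_zero p), add_zero, add_zero] at h1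
  exact h1.symm

lemma sum_Icc_filter_dvd {A : Type*} [AddCommMonoid A] (g : ℕ → A) (N : ℕ) :
    ∑ a ∈ Finset.Icc 1 (p * N) with p ∣ a, g a = ∑ b ∈ Finset.Icc 1 N, g (p * b) := by
  have hp0 := hp.1.pos
  symm
  refine Finset.sum_nbij' (fun b => p * b) (fun a => a / p) ?_ ?_ ?_ ?_ ?_
  · intro b hb
    rw [Finset.mem_Icc] at hb
    rw [Finset.mem_filter, Finset.mem_Icc]
    exact ⟨⟨Nat.mul_pos hp0 hb.1, Nat.mul_le_mul_left _ hb.2⟩, dvd_mul_right _ _⟩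
  · intro a ha
    rw [Finset.mem_filter, Finset.mem_Icc] at ha
    obtain ⟨⟨h1, h2⟩, b, rfl⟩ := ha
    rw [Nat.mul_div_cancel_left _ hp0, Finset.mem_Icc]
    exact ⟨Nat.pos_of_ne_zero (by rintro rfl; simp at h1), Nat.le_of_mul_le_mul_left h2 hp0⟩
  · intro b _
    exact Nat.mul_div_cancel_left _ hp0
  · intro a ha
    rw [Finset.mem_filter] at ha
    exact Nat.mul_div_cancel' ha.2
  · intro b _
    rfl

/-- Removing the multiples of `p` from the power sums of a multiplicative function. -/
lemma tendsto_sum_prime_to_p {K : Type*} [NormedField K] [CharZero K] {k : ℕ} (hk : 1 ≤ k)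
    {ψ : ℕ → K} (hψ : ∀ b, ψ (p * b) = ψ p * ψ b) {B : K}
    (hB : Tendsto (fun n => ((p : K) ^ n)⁻¹ * ∑ a ∈ Finset.Icc 1 (p ^ n), ψ a * (a : K) ^ k) atTop
      (𝓝 B)) :
    Tendsto (fun n => ((p : K) ^ n)⁻¹ * ∑ a ∈ Finset.range (p ^ n),
      (if p ∣ a then 0 else ψ a) * (a : K) ^ k) atTop (𝓝 ((1 - ψ p * (p : K) ^ (k - 1)) * B)) := by
  have hp0 : (p : K) ≠ 0 := by exact_mod_cast hp.1.ne_zero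
  rw [← tendsto_add_atTop_iff_nat 1]
  have h1 := ((tendsto_add_atTop_iff_nat 1).2 hB).sub (hB.const_mul (ψ p * (p : K) ^ (k - 1)))
  rw [show (1 - ψ p * (p : K) ^ (k - 1)) * B = B - ψ p * (p : K) ^ (k - 1) * B by ring]
  refine h1.congr fun n => ?_
  have h2 := Finset.sum_filter_add_sum_filter_not (Finset.Icc 1 (p ^ (n + 1))) (p ∣ ·)
    fun a => ψ a * (a : K) ^ k
  rw [sum_Icc_filter_not_dvd _ (dvd_pow_self p n.succ_ne_zero), pow_succ', sum_Icc_filter_dvd] at h2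
  have h3 : ∑ b ∈ Finset.Icc 1 (p ^ n), ψ (p * b) * ((p * b : ℕ) : K) ^ k
      = ψ p * (p : K) ^ k * ∑ b ∈ Finset.Icc 1 (p ^ n), ψ b * (b : K) ^ k := by
    rw [Finset.mul_sum]
    refine Finset.sum_congr rfl fun b _ => ?_
    rw [hψ]; push_cast; ring
  simp only [ite_mul, zero_mul]
  rw [h3] at h2
  obtain ⟨k, rfl⟩ : ∃ k', k = k' + 1 := ⟨k - 1, by omega⟩
  rw [pow_succ' p, ← h2, Nat.add_sub_cancel]
  field_simp
  ring

end PrimeToP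

/-! ### Dirichlet characters of p-power level -/

section DirichletCharacters

variable {p : ℕ} [hp : Fact p.Prime] {K : Type*} [NormedField K]

/-- A Dirichlet character as a function on the natural numbers prime to `p`. -/
def primeToP (p : ℕ) {N : ℕ} (χ : DirichletCharacter K N) (a : ℕ) : K :=
  if p ∣ a then 0 else χ (a : ZMod N)

lemma isUnit_natCast_of_not_dvd {a m : ℕ} (ha : ¬ p ∣ a) : IsUnit (a : ZMod (p ^ m)) :=
  (ZMod.isUnit_iff_coprime _ _).2
    (Nat.Coprime.pow_right _ ((Nat.Prime.coprime_iff_not_dvd hp.1).2 ha).symm)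

/-- The exponent is m + 1 so that p divides the period even at level 1. -/
lemma isPChar_primeToP {N m : ℕ} (hN : N = p ^ m) (χ : DirichletCharacter K N) :
    IsPChar p (m + 1) (primeToP p χ) := by
  subst hN
  refine ⟨fun a ha => if_pos ha, fun a b => ?_, fun a b => ?_, (p ^ m).totient,
    (Nat.totient_pos.2 (pow_pos hp.1.pos m)).ne', fun a ha => ?_⟩
  · have h1 : p ∣ a + p ^ (m + 1) * b ↔ p ∣ a :=
      Nat.dvd_add_left ((dvd_pow_self p m.succ_ne_zero).mul_right b)
    simp only [primeToP, h1]
    have h2 : ((a + p ^ (m + 1) * b : ℕ) : ZMod (p ^ m)) = a := by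
      rw [pow_succ, mul_assoc, Nat.cast_add, Nat.cast_mul, ZMod.natCast_self, zero_mul, add_zero]
    rw [h2]
  · simp only [primeToP, hp.1.dvd_mul]
    by_cases ha : p ∣ a
    · simp [ha]
    · by_cases hb : p ∣ b
      · simp [hb]
      · simp [ha, hb]
  · obtain ⟨u, hu⟩ := isUnit_natCast_of_not_dvd (m := m) ha
    rw [primeToP, if_neg ha, ← map_pow, ← hu, ← Units.val_pow_eq_pow_val, ZMod.pow_totient,
      Units.val_one, map_one]

lemma sum_range_eq_sum_zmod {A : Type*} [AddCommMonoid A] {N : ℕ} [NeZero N] (g : ZMod N → A) :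
    ∑ a ∈ Finset.range N, g (a : ZMod N) = ∑ x, g x := by
  refine Finset.sum_bij' (fun a _ => (a : ZMod N)) (fun x _ => x.val) ?_ ?_ ?_ ?_ ?_
  · intros; exact Finset.mem_univ _
  · intro x _; exact Finset.mem_range.2 (ZMod.val_lt x)
  · intro a ha; exact ZMod.val_cast_of_lt (Finset.mem_range.1 ha)
  · intro x _; exact ZMod.natCast_zmod_val x
  · intros; rfl

/-- Orthogonality on each block of length p^m; here m ≥ 1, so χ already vanishes at multiples of p.
It makes the residue zero. -/
lemma sum_primeToP_of_ne_one {N m : ℕ} (hN : N = p ^ m) {χ : DirichletCharacter K N} (hχ : χ ≠ 1)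
    {n : ℕ} (hn : m + 1 ≤ n) : ∑ a ∈ Finset.range (p ^ n), primeToP p χ a = 0 := by
  subst hN
  have hm : m ≠ 0 := by
    rintro rfl
    exact hχ (DirichletCharacter.level_one' χ (pow_zero p))
  have : NeZero (p ^ m) := ⟨pow_ne_zero _ hp.1.ne_zero⟩
  have h1 : ∀ a, primeToP p χ a = χ (a : ZMod (p ^ m)) := fun a => by
    unfold primeToP
    split_ifs with ha
    · refine (MulChar.map_nonunit χ fun h => ?_).symm
      rw [ZMod.isUnit_iff_coprime] at h
      exact hp.1.one_lt.ne' (Nat.dvd_one.1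
        (h ▸ Nat.dvd_gcd ha (dvd_pow_self p hm)))
    · rfl
  obtain ⟨e, rfl⟩ := Nat.exists_eq_add_of_le (show m ≤ n by omega)
  rw [pow_add, sum_range_mul_eq]
  refine Finset.sum_eq_zero fun j _ => ?_
  rw [← MulChar.sum_eq_zero_of_ne_one hχ, ← sum_range_eq_sum_zmod fun x => χ x]
  refine Finset.sum_congr rfl fun a _ => ?_
  rw [h1, Nat.cast_add, Nat.cast_mul, ZMod.natCast_self, zero_mul, add_zero]

lemma sum_primeToP_one {N m : ℕ} (hN : N = p ^ m) {n : ℕ} (hn : 1 ≤ n) :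
    ∑ a ∈ Finset.range (p ^ n), primeToP p (1 : DirichletCharacter K N) a
      = (p : K) ^ (n - 1) * (p - 1) := by
  subst hN
  have hp1 : 1 ≤ p := hp.1.pos
  obtain ⟨n, rfl⟩ : ∃ n', n = n' + 1 := ⟨n - 1, by omega⟩
  have h1 : ∀ a, primeToP p (1 : DirichletCharacter K (p ^ m)) a = if p ∣ a then 0 else 1 :=
    fun a => by
      unfold primeToP
      split_ifs with ha
      · rfl
      · exact MulChar.one_apply (isUnit_natCast_of_not_dvd ha)
  rw [pow_succ', sum_range_mul_eq, Nat.add_sub_cancel]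
  have h2 : ∀ j, ∑ a ∈ Finset.range p, primeToP p (1 : DirichletCharacter K (p ^ m)) (a + p * j)
      = (p : K) - 1 := fun j => by
    simp only [h1, Nat.dvd_add_left (dvd_mul_right p j)]
    obtain ⟨q, hq⟩ : ∃ q, p = q + 1 := ⟨p - 1, by omega⟩
    have h3 : ∀ a ∈ Finset.range q, (if p ∣ a + 1 then (0 : K) else 1) = 1 := fun a ha => by
      rw [if_neg fun h => ?_]
      have := Nat.le_of_dvd a.succ_pos h
      rw [Finset.mem_range] at ha
      omega
    rw [show Finset.range p = Finset.range (q + 1) by rw [← hq], Finset.sum_range_succ',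
      Finset.sum_congr rfl h3, if_pos (dvd_zero p), hq]
    simp
  rw [Finset.sum_congr rfl fun j _ => h2 j, Finset.sum_const, Finset.card_range, nsmul_eq_mul]
  push_cast
  rfl

end DirichletCharacters

/-! ### The primitive twists and the interpolated values -/

section Twist

variable {p : ℕ} [hp : Fact p.Prime]

lemma omega_natCast (a : ℕ) : omega p (a : ZMod p) = teich p ℂ_[p] a := rfl

/-- Passing to the primitive character changes nothing at numbers coprime to the level, whose only
possible prime factor is p. -/
lemma twist_natCast {N m : ℕ} (hN : N = p ^ m) (χ : DirichletCharacter ℂ_[p] N) (k : ℕ) {a : ℕ}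
    (ha : ¬ p ∣ a) :
    twist χ k (a : ZMod _) = χ (a : ZMod N) * (teich p ℂ_[p] a)⁻¹ ^ k := by
  have hc : IsCoprime (a : ℤ) (p : ℤ) :=
    Nat.isCoprime_iff_coprime.2 ((Nat.Prime.coprime_iff_not_dvd hp.1).2 ha).symm
  have hcN : IsCoprime (a : ℤ) (N : ℤ) := by
    rw [hN, Nat.cast_pow]; exact hc.pow_right
  have hl : IsCoprime (a : ℤ) ((N.lcm p : ℕ) : ℤ) := by
    refine IsCoprime.of_isCoprime_of_dvd_right (hcN.mul_right hc) ?_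
    exact_mod_cast Nat.lcm_dvd_mul N p
  have h1 := DirichletCharacter.primitiveCharacter_apply_of_isCoprime
    (χ.mul ((omega p) ^ (-(k : ℤ)))) hl
  rw [Int.cast_natCast, Int.cast_natCast] at h1
  rw [twist, DirichletCharacter.primitive_mul, h1, DirichletCharacter.mul, MulChar.mul_apply]
  have h2 := DirichletCharacter.changeLevel_eq_cast_of_dvd' χ (Nat.dvd_lcm_left N p) hl
  have h3 := DirichletCharacter.changeLevel_eq_cast_of_dvd' ((omega p) ^ (-(k : ℤ)))
    (Nat.dvd_lcm_right N p) hl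
  rw [Int.cast_natCast, Int.cast_natCast] at h2 h3
  rw [h2, h3, zpow_neg, zpow_natCast, MulChar.inv_apply_eq_inv', ← omega_natCast, inv_pow]
  congr 2
  obtain ⟨u, hu⟩ := (ZMod.isUnit_iff_coprime a p).2
    ((Nat.Prime.coprime_iff_not_dvd hp.1).2 ha).symm
  rw [← hu, MulChar.pow_apply_coe]

lemma exists_conductor_eq {N m : ℕ} (hN : N = p ^ m) (χ : DirichletCharacter ℂ_[p] N) (k : ℕ) :
    ∃ j, (χ.mul ((omega p) ^ (-(k : ℤ)))).conductor = p ^ j := by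
  have h1 := DirichletCharacter.conductor_dvd_level (χ.mul ((omega p) ^ (-(k : ℤ))))
  have h2 : (χ.mul ((omega p) ^ (-(k : ℤ)))).conductor ∣ p ^ (m + 1) := by
    refine h1.trans ?_
    rw [hN]
    exact Nat.lcm_dvd (pow_dvd_pow p (Nat.le_succ m)) (dvd_pow_self p m.succ_ne_zero)
  obtain ⟨j, -, hj⟩ := (Nat.dvd_prime_pow hp.1).1 h2
  exact ⟨j, hj⟩

lemma tendsto_generalizedBernoulli {F j : ℕ} (hF : F = p ^ j) (ψ : DirichletCharacter ℂ_[p] F)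
    {k : ℕ} (hk : 1 ≤ k) :
    Tendsto (fun n => ((p : ℂ_[p]) ^ n)⁻¹ * ∑ a ∈ Finset.range (p ^ n),
      (if p ∣ a then 0 else ψ (a : ZMod F)) * (a : ℂ_[p]) ^ k) atTop
      (𝓝 ((1 - ψ (p : ZMod F) * (p : ℂ_[p]) ^ (k - 1)) * generalizedBernoulli k ψ)) := by
  subst hF
  refine tendsto_sum_prime_to_p hk (ψ := fun a => ψ (a : ZMod (p ^ j))) (fun b => ?_) ?_
  · rw [Nat.cast_mul, map_mul]
  · refine tendsto_sum_Icc_mul_pow (ψ := fun a => ψ (a : ZMod (p ^ j))) hk j fun a b => ?_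
    rw [Nat.cast_add, Nat.cast_mul, ZMod.natCast_self, zero_mul, add_zero]

/-- The values to be interpolated in terms of the alternating sums. -/
lemma interpolationValue_mul (hp2 : 2 < p) {N m : ℕ} (hN : N = p ^ m)
    (χ : DirichletCharacter ℂ_[p] N) {k : ℕ} (hk : 1 ≤ k) {l : ℂ_[p]}
    (hl : Tendsto (fun n => ∑ a ∈ Finset.range (p ^ n), (-1) ^ a / 2 *
      (primeToP p χ a * (a : ℂ_[p])⁻¹ * emb ℂ_[p] (onePow (angle (a : ℤ_[p])) (k : ℤ_[p]))))
      atTop (𝓝 l)) :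
    (1 - χ 2 * emb ℂ_[p] (onePow (angle ((2 : ℕ) : ℤ_[p])) (k : ℤ_[p]))) * interpolationValue χ k
      = -l := by
  have hk0 : (k : ℂ_[p]) ≠ 0 := by exact_mod_cast (by omega : k ≠ 0)
  set c : ℕ → ℂ_[p] := fun a => primeToP p χ a * (teich p ℂ_[p] a)⁻¹ ^ k with hc
  have hcc : IsPChar p (m + 1) c := (isPChar_primeToP hN χ).mul_teich_inv_pow k
  obtain ⟨j, hj⟩ := exists_conductor_eq hN χ k
  have h1 := tendsto_generalizedBernoulli hj (twist χ k) hk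
  have h2 : ∀ a : ℕ, (if p ∣ a then 0 else twist χ k (a : ZMod _)) = c a := fun a => by
    rw [hc]
    simp only [primeToP]
    split_ifs with ha
    · rw [zero_mul]
    · exact twist_natCast hN χ k ha
  simp only [h2] at h1
  have h3 : ∀ a : ℕ, primeToP p χ a * (a : ℂ_[p])⁻¹ *
      emb ℂ_[p] (onePow (angle (a : ℤ_[p])) (k : ℤ_[p])) = c a * (a : ℂ_[p]) ^ (k - 1) := by
    intro a
    by_cases ha : p ∣ a
    · simp [hc, primeToP, ha]
    · have ha0 : (a : ℂ_[p]) ≠ 0 := by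
        rintro h0
        exact ha (by rw [Nat.cast_eq_zero.1 h0]; exact dvd_zero p)
      rw [emb_onePow_angle ha, hc, ← pow_sub_one_mul (by omega : k ≠ 0) (a : ℂ_[p])]
      field_simp
  simp only [h3] at hl
  have h4 := hcc.eq_of_tendsto hp2 hk h1 hl
  have h5 : c 2 * 2 ^ k
      = χ 2 * emb ℂ_[p] (onePow (angle ((2 : ℕ) : ℤ_[p])) (k : ℤ_[p])) := by
    rw [emb_onePow_angle (not_dvd_two hp2), hc]
    simp only [primeToP, if_neg (not_dvd_two hp2), Nat.cast_ofNat]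
    ring
  rw [← h5, interpolationValue]
  field_simp
  linear_combination -h4

end Twist

/-! ### Uniqueness of the interpolation -/

section Interpolation

variable {p : ℕ} [hp : Fact p.Prime]

/-- Natural numbers are dense in ℤ_p, so the limit defining L_p(s, χ) is over a nontrivial filter
and is determined by any continuous interpolation. -/
lemma neBot_comap (s : ℤ_[p]) :
    (Filter.comap (fun k : ℕ+ => 1 - ((k : ℕ) : ℤ_[p])) (𝓝 s)).NeBot := by
  rw [Filter.comap_neBot_iff]
  intro t ht
  obtain ⟨u, hut, huo, hsu⟩ := mem_nhds_iff.1 ht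
  have h1 : IsOpen ((fun x : ℤ_[p] => -x) ⁻¹' u) := huo.preimage continuous_neg
  obtain ⟨k, hk⟩ := PadicInt.denseRange_natCast.exists_mem_open h1 ⟨-s, by simpa using hsu⟩
  exact ⟨⟨k + 1, k.succ_pos⟩, hut (by simpa using hk)⟩

lemma padicLFunction_eq {N : ℕ} {χ : DirichletCharacter ℂ_[p] N} {g : ℤ_[p] → ℂ_[p]} {s : ℤ_[p]}
    (hg : ContinuousAt g s)
    (h : ∀ k : ℕ, 1 ≤ k → g (1 - (k : ℤ_[p])) = interpolationValue χ k) :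
    padicLFunction χ s = g s := by
  have := neBot_comap s
  refine Tendsto.limUnder_eq ?_
  refine (hg.tendsto.comp tendsto_comap).congr fun k => ?_
  exact h k k.2

end Interpolation

/-! ### Division by 1 - χ(2)⟨2⟩^t and assembly -/

section Main

open PowerSeries

variable {p : ℕ} [hp : Fact p.Prime]

lemma IsBdd.isAnalyticOnZp {C : ℝ} {f : ℂ_[p]⟦X⟧} (hf : IsBdd p C f) :
    IsAnalyticOnZp (ev f : ℤ_[p] → ℂ_[p]) :=
  ⟨fun j => coeff j f, hf.tendsto_coeff, fun s => hf.hasSum s⟩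

/-- Otherwise 2 = ω(2), hence 2^{p-1} = 1 in characteristic zero. -/
lemma angle_two_ne_one (hp2 : 2 < p) : angle ((2 : ℕ) : ℤ_[p]) ≠ 1 := by
  intro h
  have h1 : emb ℚ_[p] (angle ((2 : ℕ) : ℤ_[p])) = 1 := by rw [h, map_one]
  rw [emb_angle] at h1
  have h2 : (2 : ℚ_[p]) ^ (p - 1) = 1 := by
    have h3 := congrArg (· ^ (p - 1)) h1
    simpa [mul_pow, teich_pow_eq_one p ℚ_[p] (not_dvd_two hp2)] using h3
  have h4 : 2 ^ (p - 1) = 1 := by exact_mod_cast h2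
  exact (Nat.one_lt_two_pow (by omega)).ne' h4

/-- After division by t, the constant term gives the polar part and q the regular part. -/
lemma IsBdd.exists_eq_C_add_X_mul {C' : ℝ} {f : ℂ_[p]⟦X⟧} (hf : IsBdd p C' f) :
    ∃ q : ℂ_[p]⟦X⟧, IsBdd p (C' * rad p) q ∧
      ∀ t : ℤ_[p], ev f t = coeff 0 f + emb ℂ_[p] t * ev q t := by
  refine ⟨PowerSeries.mk fun j => coeff (j + 1) f, fun j => ?_, fun t => ?_⟩
  · rw [coeff_mk, mul_assoc, ← pow_succ']
    exact hf (j + 1)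
  · have h1 := (hf.hasSum t).summable
    rw [ev, h1.tsum_eq_zero_add, pow_zero, mul_one, ev, ← tsum_mul_left]
    congr 1
    refine tsum_congr fun j => ?_
    rw [coeff_mk]
    ring

/-- The limit formula for the `p`-adic `L`-function together with its analyticity, as a statement
about its numerator `l`, its residue `r` and its regular part `g`. -/
lemma exists_numerator_residue_regular (hp2 : 2 < p) {N m : ℕ} (hN : N = p ^ m)
    (χ : DirichletCharacter ℂ_[p] N) :
    ∃ (l g : ℤ_[p] → ℂ_[p]) (r : ℂ_[p]),
      (∀ s, Tendsto (fun n => ∑ a ∈ Finset.range (p ^ n), (-1) ^ a / 2 *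
        (primeToP p χ a * (a : ℂ_[p])⁻¹ * emb ℂ_[p] (onePow (angle (a : ℤ_[p])) (1 - s))))
        atTop (𝓝 (l s))) ∧
      IsAnalyticOnZp g ∧ Continuous g ∧ (χ ≠ 1 → r = 0) ∧ (χ = 1 → r ≠ 0) ∧
      ∀ s, ¬ (s = 1 ∧ χ 2 = 1) →
        1 - χ 2 * emb ℂ_[p] (onePow (angle ((2 : ℕ) : ℤ_[p])) (1 - s)) ≠ 0 ∧
        r / (emb ℂ_[p] s - 1) + g s
          = -(1 - χ 2 * emb ℂ_[p] (onePow (angle ((2 : ℕ) : ℤ_[p])) (1 - s)))⁻¹ * l s := by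
  have hc := isPChar_primeToP hN χ
  have hc2 : primeToP p χ 2 = χ 2 := by simp [primeToP, not_dvd_two hp2]
  obtain ⟨e, he, hroot⟩ := hc.root
  have hz := hroot 2 (not_dvd_two hp2)
  rw [hc2] at hz
  obtain ⟨f, hf, hft⟩ := hc.exists_tendsto_ev hp2
  have hu := norm_angle_sub_one_lt (not_dvd_two hp2)
  by_cases h2 : χ 2 = 1
  · obtain ⟨D, h, hh, hne, hht⟩ := exists_mul_one_sub_eq_self (K := ℂ_[p]) hp2 hu
      (angle_two_ne_one hp2)
    have hB : ∃ r : ℂ_[p], (χ ≠ 1 → r = 0) ∧ (χ = 1 → r ≠ 0) ∧ ∀ n, m + 1 ≤ n →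
        ((p : ℂ_[p]) ^ n)⁻¹ * ∑ a ∈ Finset.range (p ^ n), primeToP p χ a = r := by
      by_cases h1 : χ = 1
      · have hp0 : (p : ℂ_[p]) ≠ 0 := by exact_mod_cast hp.1.ne_zero
        have hp1 : (p : ℂ_[p]) - 1 ≠ 0 := sub_ne_zero.2 (by exact_mod_cast hp.1.one_lt.ne')
        refine ⟨((p : ℂ_[p]) - 1) / p, fun h => absurd h1 h, fun _ => div_ne_zero hp1 hp0,
          fun n hn => ?_⟩
        obtain ⟨n, rfl⟩ : ∃ n', n = n' + 1 := ⟨n - 1, by omega⟩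
        rw [h1, sum_primeToP_one hN (by omega), Nat.add_sub_cancel, pow_succ]
        field_simp
      · exact ⟨0, fun _ => rfl, fun h => absurd h h1, fun n hn => by
          rw [sum_primeToP_of_ne_one hN h1 hn, mul_zero]⟩
    obtain ⟨r, hr0, hr1, hr⟩ := hB
    have h0 := hc.ev_zero_mul hp2 (hc2.trans h2) hh (hft 0) hht hr
    have hfh := hf.mul hh
    obtain ⟨q, hq, hqt⟩ := hfh.exists_eq_C_add_X_mul
    rw [← ev_zero (p := p), ev_mul hf hh, h0] at hqt
    -- The quotient is -f(t)h(t)/t = -r/t - q(t) with t = 1 - s, whence the residue r at s = 1 and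
    -- the regular part -q(1 - s).
    obtain ⟨g, hg, hgt⟩ := ((isBdd_C (p := p) (-1 : ℂ_[p])).mul hq).exists_one_sub
    refine ⟨fun s => ev f (1 - s), ev g, r, fun s => hft (1 - s), hg.isAnalyticOnZp,
      hg.continuous, hr0, hr1, fun s hs => ?_⟩
    have hs1 : 1 - s ≠ 0 := fun h => hs ⟨(sub_eq_zero.1 h).symm, h2⟩
    have ht0 : emb ℂ_[p] (1 - s) ≠ 0 := (map_ne_zero_iff _ (emb_injective ℂ_[p])).2 hs1
    have h3 := hht (1 - s)
    have h4 := hqt (1 - s)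
    rw [ev_mul hf hh] at h4
    have hD : 1 - emb ℂ_[p] (onePow (angle ((2 : ℕ) : ℤ_[p])) (1 - s)) ≠ 0 := by
      intro h5
      rw [h5, mul_zero] at h3
      exact ht0 h3.symm
    rw [h2, one_mul]
    refine ⟨hD, ?_⟩
    rw [hgt, ev_mul (isBdd_C _) hq, ev_C]
    have h5 : emb ℂ_[p] s - 1 = -emb ℂ_[p] (1 - s) := by rw [map_sub, map_one]; ring
    rw [h5, div_neg, neg_one_mul, ← neg_add, neg_mul, neg_inj, eq_inv_mul_iff_mul_eq₀ hD,
      div_add' _ _ _ ht0, mul_div_assoc', div_eq_iff ht0, mul_comm (ev q _), ← h4, ← h3]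
    ring
  · have hz1 : rad p ≤ ‖χ 2 - 1‖ := by
      by_contra hlt
      exact h2 (eq_one_of_pow_eq_one hp2 he hz (not_le.1 hlt))
    obtain ⟨D, h, hh, hht⟩ := exists_mul_one_sub_eq_one hp2 hu
      (norm_eq_one_of_pow_eq_one he hz).le hz1
    obtain ⟨g, hg, hgt⟩ := ((isBdd_C (p := p) (-1 : ℂ_[p])).mul (hh.mul hf)).exists_one_sub
    have h1 : χ ≠ 1 := by
      intro h1
      subst hN
      have := isUnit_natCast_of_not_dvd (m := m) (not_dvd_two hp2)
      rw [Nat.cast_ofNat] at this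
      exact h2 (by rw [h1, MulChar.one_apply this])
    refine ⟨fun s => ev f (1 - s), ev g, 0, fun s => hft (1 - s), hg.isAnalyticOnZp,
      hg.continuous, fun _ => rfl, fun h => absurd h h1, fun s _ => ?_⟩
    have h3 := hht (1 - s)
    refine ⟨right_ne_zero_of_mul_eq_one h3, ?_⟩
    rw [hgt, ev_mul (isBdd_C _) (hh.mul hf), ev_C, ev_mul hh hf, zero_div, zero_add,
      eq_inv_of_mul_eq_one_left h3]
    ring

lemma term_eq {N : ℕ} (χ : DirichletCharacter ℂ_[p] N) {a : ℕ} (ha : ¬ p ∣ a) (s : ℤ_[p]) :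
    χ (a : ZMod N) * (omega p (a : ZMod p))⁻¹ * anglePow a (-s)
      = primeToP p χ a * (a : ℂ_[p])⁻¹ * emb ℂ_[p] (onePow (angle (a : ℤ_[p])) (1 - s)) := by
  have ha0 : (a : ℂ_[p]) ≠ 0 := by
    rintro h0
    exact ha (by rw [Nat.cast_eq_zero.1 h0]; exact dvd_zero p)
  have h1 := onePow_sub_one_mul (norm_angle_sub_one_lt ha) (1 - s)
  rw [sub_sub_cancel_left] at h1
  rw [← h1, map_mul, emb_angle, primeToP, if_neg ha, omega_natCast, anglePow, ← emb_apply]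
  field_simp

/-- The level is given by an equation so that powers of ω, of level p, are covered without a cast.
-/
theorem padicLFunction_formulas (hp2 : 2 < p) {N m : ℕ} (hN : N = p ^ m)
    (χ : DirichletCharacter ℂ_[p] N) :
    (∀ k : ℕ, 1 ≤ k → padicLFunction χ (1 - (k : ℤ_[p])) = interpolationValue χ k) ∧
    (∀ s : ℤ_[p], ∃ l : ℂ_[p],
      Tendsto (fun n : ℕ => ∑ a ∈ Finset.Icc 1 (p ^ n) with ¬ p ∣ a,
        (-1 : ℂ_[p]) ^ a / 2 * (χ (a : ZMod N) * (omega p (a : ZMod p))⁻¹) * anglePow a (-s))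
        atTop (𝓝 l) ∧
      (¬ (s = 1 ∧ χ 2 = 1) →
        1 - χ 2 * anglePow 2 (1 - s) ≠ 0 ∧
        padicLFunction χ s = -(1 - χ 2 * anglePow 2 (1 - s))⁻¹ * l)) ∧
    (χ ≠ 1 → IsAnalyticOnZp (padicLFunction χ)) ∧
    (χ = 1 → IsAnalyticWithSimplePoleAtOne (padicLFunction χ)) := by
  obtain ⟨l, g, r, hl, hga, hgc, hr0, hr1, hlg⟩ := exists_numerator_residue_regular hp2 hN χ
  have hval : ∀ k : ℕ, 1 ≤ k → r / (emb ℂ_[p] (1 - (k : ℤ_[p])) - 1) + g (1 - (k : ℤ_[p]))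
      = interpolationValue χ k := fun k hk => by
    have hk0 : (k : ℤ_[p]) ≠ 0 := by exact_mod_cast (by omega : k ≠ 0)
    obtain ⟨h1, h2⟩ := hlg (1 - (k : ℤ_[p])) fun h => hk0 (by simpa using h.1)
    have h3 := hl (1 - (k : ℤ_[p]))
    rw [sub_sub_cancel] at h1 h2 h3
    have h4 := interpolationValue_mul hp2 hN χ hk h3
    rw [h2, neg_mul, ← mul_neg, ← h4, inv_mul_cancel_left₀ h1]
  have hL : ∀ s, (s ≠ 1 ∨ χ ≠ 1) → padicLFunction χ s = r / (emb ℂ_[p] s - 1) + g s := by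
    intro s hs
    refine padicLFunction_eq (g := fun s => r / (emb ℂ_[p] s - 1) + g s) ?_ hval
    refine ContinuousAt.add ?_ hgc.continuousAt
    by_cases h1 : χ = 1
    · refine continuousAt_const.div ((continuous_emb ℂ_[p]).continuousAt.sub continuousAt_const) ?_
      rw [sub_ne_zero, ← map_one (emb (p := p) ℂ_[p])]
      exact fun h => (hs.resolve_right (not_not.2 h1)) (emb_injective ℂ_[p] h)
    · simp only [hr0 h1, zero_div]
      exact continuousAt_const
  -- The trivial character takes the value 1 at 2, a unit modulo p^m.
  have hχ2 : ∀ s : ℤ_[p], ¬ (s = 1 ∧ χ 2 = 1) → s ≠ 1 ∨ χ ≠ 1 := fun s hs => by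
    by_contra! h
    refine hs ⟨h.1, ?_⟩
    subst hN
    have := isUnit_natCast_of_not_dvd (m := m) (not_dvd_two hp2)
    rw [Nat.cast_ofNat] at this
    rw [h.2, MulChar.one_apply this]
  refine ⟨fun k hk => ?_, fun s => ⟨l s, ?_, fun hs => ?_⟩, fun h1 => ?_, fun h1 => ?_⟩
  · have hk0 : (k : ℤ_[p]) ≠ 0 := by exact_mod_cast (by omega : k ≠ 0)
    rw [hL _ (Or.inl fun h => hk0 (by simpa using h)), hval k hk]
  · refine (hl s).congr' (eventually_atTop.2 ⟨1, fun n hn => ?_⟩)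
    beta_reduce
    rw [sum_Icc_filter_not_dvd _ (dvd_pow_self p (by omega))]
    refine Finset.sum_congr rfl fun a _ => ?_
    split_ifs with ha
    · simp [primeToP, ha]
    · rw [← term_eq χ ha]; ring
  · obtain ⟨h1, h2⟩ := hlg s hs
    exact ⟨h1, (hL s (hχ2 s hs)).trans h2⟩
  · have h2 : padicLFunction χ = g := funext fun s => by
      rw [hL s (Or.inr h1), hr0 h1, zero_div, zero_add]
    rwa [h2]
  · exact ⟨r, g, hr1 h1, hga, fun s hs => hL s (Or.inl hs)⟩

/-- At a = 0 this fails for i = 0, where the character gives 0 and the power gives 1. -/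
lemma omega_zpow_apply {a : ZMod p} (ha : IsUnit a) (i : ℤ) :
    ((omega p) ^ i) a = (omega p a) ^ i := by
  obtain ⟨u, rfl⟩ := ha
  cases i with
  | ofNat i => rw [Int.ofNat_eq_natCast, zpow_natCast, zpow_natCast, MulChar.pow_apply_coe]
  | negSucc i =>
    rw [zpow_negSucc, zpow_negSucc, MulChar.inv_apply_eq_inv', MulChar.pow_apply_coe]

end Main

end

end PadicDirichlet

theorem mainTheorem2 (p : ℕ) [Fact p.Prime] (hp : 2 < p) :
    (∀ (m : ℕ) (χ : DirichletCharacter ℂ_[p] (p ^ m)),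
      (∀ k : ℕ, 1 ≤ k → PadicDirichlet.padicLFunction χ (1 - (k : ℤ_[p])) =
        PadicDirichlet.interpolationValue χ k) ∧
      (∀ s : ℤ_[p], ∃ l : ℂ_[p],
        Tendsto (fun n : ℕ => ∑ a ∈ Finset.Icc 1 (p ^ n) with ¬ p ∣ a,
          (-1 : ℂ_[p]) ^ a / 2 * (χ (a : ZMod (p ^ m)) * (PadicDirichlet.omega p (a : ZMod p))⁻¹) *
            PadicDirichlet.anglePow a (-s)) atTop (𝓝 l) ∧
        (¬ (s = 1 ∧ χ 2 = 1) →
          1 - χ 2 * PadicDirichlet.anglePow 2 (1 - s) ≠ 0 ∧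
          PadicDirichlet.padicLFunction χ s =
            -(1 - χ 2 * PadicDirichlet.anglePow 2 (1 - s))⁻¹ * l)) ∧
      (χ ≠ 1 → PadicDirichlet.IsAnalyticOnZp (PadicDirichlet.padicLFunction χ)) ∧
      (χ = 1 → PadicDirichlet.IsAnalyticWithSimplePoleAtOne (PadicDirichlet.padicLFunction χ))) ∧
    (∀ i : ℕ, i ≤ p - 2 → ∀ s : ℤ_[p], ∃ l : ℂ_[p],
      Tendsto (fun n : ℕ => ∑ a ∈ Finset.Icc 1 (p ^ n) with ¬ p ∣ a,
        (-1 : ℂ_[p]) ^ a / 2 * (PadicDirichlet.omega p (a : ZMod p)) ^ (-(i : ℤ)) *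
          PadicDirichlet.anglePow a (-s)) atTop (𝓝 l) ∧
      (¬ (s = 1 ∧ (PadicDirichlet.omega p 2) ^ (1 - (i : ℤ)) = 1) →
        1 - (PadicDirichlet.omega p 2) ^ (1 - (i : ℤ)) * PadicDirichlet.anglePow 2 (1 - s) ≠ 0 ∧
        PadicDirichlet.padicZetaBranch p i s =
          -(1 - (PadicDirichlet.omega p 2) ^ (1 - (i : ℤ)) *
            PadicDirichlet.anglePow 2 (1 - s))⁻¹ * l)) := by
  refine ⟨fun m χ => PadicDirichlet.padicLFunction_formulas hp rfl χ, fun i _ s => ?_⟩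
  have hunit : ∀ a : ℕ, ¬ p ∣ a → IsUnit (a : ZMod p) := fun a ha =>
    isUnit_iff_ne_zero.2 (by rwa [Ne, ZMod.natCast_eq_zero_iff])
  have h2 : ((PadicDirichlet.omega p) ^ (1 - (i : ℤ))) 2
      = (PadicDirichlet.omega p 2) ^ (1 - (i : ℤ)) :=
    PadicDirichlet.omega_zpow_apply
      (by simpa using hunit 2 (PadicDirichlet.not_dvd_two hp)) _
  obtain ⟨l, hl, hs⟩ := (PadicDirichlet.padicLFunction_formulas hp (pow_one p).symm
    ((PadicDirichlet.omega p) ^ (1 - (i : ℤ)))).2.1 s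
  rw [h2] at hs
  refine ⟨l, hl.congr fun n => Finset.sum_congr rfl fun a ha => ?_, hs⟩
  have ha' := hunit a (Finset.mem_filter.1 ha).2
  -- For χ = ω^{1-i} the factor χω^{-1} is ω^{-i}.
  rw [PadicDirichlet.omega_zpow_apply ha', ← zpow_neg_one,
    ← zpow_add₀ ((ha'.map (PadicDirichlet.omega p)).ne_zero)]
  congr 3
  ring
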